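/- **Conventions.** Let $\mathbb F$ be a field and $G$ an abelian group, written multiplicatively, with neutral element $e$. An algebra is an $\mathbb F$-vector space with a bilinear multiplication; no associativity, unit, or restriction on the dimension is assumed. A $G$-grading on an algebra $A$ is a vector space decomposition $A=\bigoplus_{g\in G}A_g$ with $A_gA_h\subseteq A_{gh}$. We write $A\simeq_G A'$ if there is an algebra isomorphism $\varphi:A\to A'$ with $\varphi(A_g)=A'_g$ for all $g\in G$. The centroid of $A$ is $C(A)=\{c\in\operatorname{End}_{\mathbb F}(A)\mid c(xy)=c(x)y=xc(y)\ \forall x,y\in A\}$, and, for $A$ graded by $G$, $C(A)_g=\{c\in C(A)\mid cA_{g'}\subseteq A_{gg'}\ \forall g'\in G\}$. An algebra $A$ is *central simple* if $A^2\neq 0$, its only ideals are $0$ and $A$, and $C(A)=\mathbb F1$. A $G$-graded algebra $A$ is *graded-central-simple* if $A\ne0$, $A^2=A$, its only graded ideals are $0$ and $A$, and $C(A)_e=\mathbb F1$. For abelian groups $K,M$, $\mathrm Z^2_{\mathrm{sym}}(K,M)$ denotes the group of symmetric maps $\sigma:K\times K\to M$ with $\sigma(a,b)\sigma(ab,c)=\sigma(a,bc)\sigma(b,c)$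 for all $a,b,c\in K$, and $\mathrm H^2_{\mathrm{sym}}(K,M)$ its quotient by the subgroup of the coboundaries $(a,b)\mapsto\gamma(a)\gamma(b)\gamma(ab)^{-1}$, for maps $\gamma:K\to M$. A homomorphism $f:K'\to K$ induces $f^*:\mathrm H^2_{\mathrm{sym}}(K,M)\to \mathrm H^2_{\mathrm{sym}}(K',M)$, $[\sigma]\mapsto[\sigma\circ(f\times f)]$. For a $K$-graded algebra $A$ and $\tau\in \mathrm Z^2_{\mathrm{sym}}(K,\mathbb F^\times)$, the twist $A^\tau$ is the $K$-graded space $A$ with the new multiplication $x*y=\tau(a,b)xy$ for $x\in A_a$, $y\in A_b$; in particular $\mathbb F^\tau K=(\mathbb FK)^\tau$ is the twisted group algebra. For a subgroup $H\le G$ with canonical projection $\pi:G\to G/H$ and a $G/H$-graded algebra $A$, the loop algebra is the $G$-graded algebra $L_\pi(A)=\bigoplus_{g\in G}A_{\pi(g)}\otimes g\subseteq A\otimes_{\mathbb F}\mathbb FG$, and $L_\pi^\tau(A)=(L_\pi(A))^\tau$ for $\tau\in \mathrm Z^2_{\mathrm{sym}}(G,\mathbb F^\times)$. **Theorem.** 1.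 If $B$ is a $G$-graded-central-simple algebra, then the support $H=\{g\in G\mid C(B)_g\neq0\}$ of its centroid is a subgroup of $G$, and there are a $G/H$-graded algebra $A$ that is central simple (as an ungraded algebra) and a cocycle $\tau\in \mathrm Z^2_{\mathrm{sym}}(G,\mathbb F^\times)$ such that $B\simeq_G L_\pi^\tau(A)$. 2. Conversely, let $H$ be a subgroup of $G$, $A$ a central simple and $G/H$-graded algebra, and $\tau\in \mathrm Z^2_{\mathrm{sym}}(G,\mathbb F^\times)$. Then $L^\tau_\pi(A)$ is $G$-graded-central-simple, and $C(L^\tau_\pi(A))\simeq_G\mathbb F^{\tau'}H$, where $\tau'=\tau|_{H\times H}$ and $\mathbb F^{\tau'}H$ is $G$-graded with zero components outside $H$. 3. For $i=1,2$, let $H_i$ be a subgroup of $G$ with canonical projection $\pi_i:G\to G/H_i$, $A_i$ a central simple and $G/H_i$-graded algebra, and $\tau_i\in \mathrm Z^2_{\mathrm{sym}}(G,\mathbb F^\times)$. Then $L_{\pi_1}^{\tau_1}(A_1)\simeq_G L_{\pi_2}^{\tau_2}(A_2)$ if and only if $H_1=H_2=:H$ (so that $\pi_1=\pi_2=:\pi$)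 and there is $\mu\in \mathrm Z^2_{\mathrm{sym}}(G/H,\mathbb F^\times)$ such that $[\tau_1]=\pi^*([\mu])[\tau_2]$ in $\mathrm H^2_{\mathrm{sym}}(G,\mathbb F^\times)$ and $A_1^\mu\simeq_{G/H}A_2$. -/

import Mathlib

open scoped TensorProduct

/-! ### Symmetric 2-cocycles and `H²_sym` (trivial action, multiplicative notation) -/

/-- The group `Z²_sym(A, B)` of symmetric `2`-cocycles `A × A → B`. -/
def Z2Sym (A B : Type*) [CommGroup A] [CommGroup B] : Subgroup (A × A → B) where
  carrier := {σ |
    (∀ a₁ a₂ a₃ : A, σ (a₁, a₂) * σ (a₁ * a₂, a₃) = σ (a₁, a₂ * a₃) * σ (a₂, a₃)) ∧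
    ∀ a₁ a₂ : A, σ (a₁, a₂) = σ (a₂, a₁)}
  one_mem' := by simp
  mul_mem' := by
    rintro σ τ ⟨h₁, h₂⟩ ⟨k₁, k₂⟩
    refine ⟨fun a b c => ?_, fun a b => ?_⟩
    · simp only [Pi.mul_apply]
      rw [mul_mul_mul_comm, h₁, k₁, mul_mul_mul_comm]
    · simp only [Pi.mul_apply]
      rw [h₂, k₂]
  inv_mem' := by
    rintro σ ⟨h₁, h₂⟩
    refine ⟨fun a b c => ?_, fun a b => ?_⟩
    · simp only [Pi.inv_apply]
      rw [← mul_inv, h₁, mul_inv]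
    · simp only [Pi.inv_apply]
      rw [h₂]

/-- The subgroup `B²(A, B)` of `2`-coboundaries
`dγ(a₁, a₂) = γ(a₁) γ(a₂) γ(a₁ a₂)⁻¹`, inside `Z²_sym(A, B)`. -/
def B2 (A B : Type*) [CommGroup A] [CommGroup B] : Subgroup (Z2Sym A B) where
  carrier := {σ | ∃ γ : A → B, ∀ a₁ a₂ : A, σ.1 (a₁, a₂) = γ a₁ * γ a₂ * (γ (a₁ * a₂))⁻¹}
  one_mem' := ⟨1, by simp⟩
  mul_mem' := by
    rintro σ τ ⟨γ, h⟩ ⟨δ, k⟩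
    refine ⟨γ * δ, fun a b => ?_⟩
    simp only [Subgroup.coe_mul, Pi.mul_apply, h, k, mul_inv]
    rw [mul_mul_mul_comm, mul_mul_mul_comm (γ a)]
  inv_mem' := by
    rintro σ ⟨γ, h⟩
    refine ⟨γ⁻¹, fun a b => ?_⟩
    simp only [Subgroup.coe_inv, Pi.inv_apply, h, mul_inv]

/-- `H²_sym(A, B) = Z²_sym(A, B) / B²(A, B)`. -/
abbrev H2Sym (A B : Type*) [CommGroup A] [CommGroup B] : Type _ := Z2Sym A B ⧸ B2 A B

/-- The class `[σ]` of a symmetric cocycle. -/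
abbrev H2Sym.mk {A B : Type*} [CommGroup A] [CommGroup B] (σ : Z2Sym A B) : H2Sym A B :=
  QuotientGroup.mk σ

/-- Pull-back of cocycles, `σ ↦ σ ∘ (f × f)`. -/
def Z2Sym.comap {A' A : Type*} (B : Type*) [CommGroup A'] [CommGroup A] [CommGroup B]
    (f : A' →* A) : Z2Sym A B →* Z2Sym A' B where
  toFun σ := ⟨fun p => σ.1 (f p.1, f p.2),
    fun a b c => by simpa only [map_mul] using σ.2.1 (f a) (f b) (f c),
    fun a b => σ.2.2 (f a) (f b)⟩
  map_one' := rfl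
  map_mul' _ _ := rfl

/-- The induced map `f^* : H²_sym(A, B) → H²_sym(A', B)`, `[σ] ↦ [σ ∘ (f × f)]`. -/
def H2Sym.comap {A' A : Type*} (B : Type*) [CommGroup A'] [CommGroup A] [CommGroup B]
    (f : A' →* A) : H2Sym A B →* H2Sym A' B :=
  QuotientGroup.map (B2 A B) (B2 A' B) (Z2Sym.comap B f) (by
    rintro σ ⟨γ, h⟩
    refine ⟨γ ∘ f, fun a b => ?_⟩
    change σ.1 (f a, f b) = γ (f a) * γ (f b) * (γ (f (a * b)))⁻¹
    rw [map_mul]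
    exact h (f a) (f b))

/-! ### Algebras (no associativity, unit or finiteness is assumed), simplicity, centroid -/

section Algebras

variable (F : Type*) [Field F] (A : Type*) [NonUnitalNonAssocRing A] [Module F A]

/-- A two-sided ideal of an algebra: a subspace stable under all multiplications. -/
def IsAlgIdeal {F : Type*} [Field F] {A : Type*} [NonUnitalNonAssocRing A] [Module F A]
    (I : Submodule F A) : Prop :=
  ∀ x ∈ I, ∀ a : A, a * x ∈ I ∧ x * a ∈ I

/-- A simple algebra: nonzero multiplication, and no ideals besides `0` and `A`. -/
def IsSimpleAlg : Prop :=
  (∃ x y : A, x * y ≠ 0) ∧ ∀ I : Submodule F A, IsAlgIdeal I → I = ⊥ ∨ I = ⊤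

variable [IsScalarTower F A A] [SMulCommClass F A A]

/-- The centroid `C(A) = {c ∈ End_F(A) | c(xy) = c(x)y = xc(y)}`. -/
def centroid : Subalgebra F (Module.End F A) where
  carrier := {c | ∀ x y : A, c (x * y) = c x * y ∧ c (x * y) = x * c y}
  mul_mem' := by
    intro c d hc hd x y
    simp only [Module.End.mul_apply]
    exact ⟨by rw [(hd x y).1, (hc _ _).1], by rw [(hd x y).2, (hc _ _).2]⟩
  add_mem' := by
    intro c d hc hd x y
    simp only [LinearMap.add_apply]
    exact ⟨by rw [(hd x y).1, (hc _ _).1, add_mul], by rw [(hd x y).2, (hc _ _).2, mul_add]⟩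
  algebraMap_mem' := by
    intro r x y
    simp only [Module.algebraMap_end_apply]
    exact ⟨(smul_mul_assoc r x y).symm, (mul_smul_comm r x y).symm⟩

/-- A central simple algebra: simple, with centroid `F 1`. -/
def IsCentralSimpleAlg : Prop :=
  IsSimpleAlg F A ∧ centroid F A = ⊥

end Algebras

/-! ### Gradings -/

/-- A `G`-grading `A = ⨁ A_g` on an algebra `A`, with `A_g A_h ⊆ A_{gh}`. -/
structure Grading (F G A : Type*) [Field F] [CommGroup G] [NonUnitalNonAssocRing A]
    [Module F A] where
  /-- the homogeneous components -/
  comp : G → Submodule F A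
  /-- the sum of the components is direct -/
  indep : iSupIndep comp
  /-- the components span the algebra -/
  iSup_comp : ⨆ g, comp g = ⊤
  mul_mem : ∀ g h : G, ∀ x ∈ comp g, ∀ y ∈ comp h, x * y ∈ comp (g * h)

/-- Graded isomorphism `A ≃_G B`: an algebra isomorphism `φ` with `φ(A_g) = B_g` for all `g`. -/
def GradedIso {F G A B : Type*} [Field F] [NonUnitalNonAssocRing A] [Module F A]
    [NonUnitalNonAssocRing B] [Module F B]
    (𝒜 : G → Submodule F A) (ℬ : G → Submodule F B) : Prop :=
  ∃ φ : A ≃ₗ[F] B, (∀ x y : A, φ (x * y) = φ x * φ y) ∧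
    ∀ g : G, (𝒜 g).map (φ : A →ₗ[F] B) = ℬ g

/-- A family of subspaces indexed by a subgroup `H`, extended by zero to a family indexed by `G`.
An `H`-graded algebra is regarded as a `G`-graded algebra in this way. -/
def extendByZero {F G A : Type*} [Field F] [CommGroup G] [AddCommGroup A] [Module F A]
    (H : Subgroup G) (𝒜 : H → Submodule F A) (g : G) : Submodule F A :=
  ⨆ (h : H) (_ : (h : G) = g), 𝒜 h

/-- A criterion for a family of subspaces to be independent. -/
theorem iSupIndep_of_proj {F V W G : Type*} [Field F] [AddCommGroup V] [Module F V]
    [AddCommGroup W] [Module F W] (S : G → Submodule F V) (P : G → V →ₗ[F] W)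
    (h₁ : ∀ g, ∀ x ∈ S g, P g x = 0 → x = 0)
    (h₂ : ∀ g h, h ≠ g → ∀ x ∈ S h, P g x = 0) : iSupIndep S := by
  intro g
  rw [Submodule.disjoint_def]
  intro x hx hx'
  refine h₁ g x hx ?_
  have : (⨆ (j) (_ : j ≠ g), S j) ≤ LinearMap.ker (P g) :=
    iSup₂_le fun j hj y hy => LinearMap.mem_ker.2 (h₂ g j hj y hy)
  exact LinearMap.mem_ker.1 (this hx')

section Graded

variable {F G A : Type*} [Field F] [CommGroup G] [NonUnitalNonAssocRing A] [Module F A]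

/-- A graded-simple algebra: `A ≠ 0`, `A² = A`, and no graded ideals besides `0` and `A`. -/
def IsGradedSimple (𝒜 : Grading F G A) : Prop :=
  Nontrivial A ∧
  Submodule.span F {z : A | ∃ x y : A, z = x * y} = ⊤ ∧
  ∀ I : Submodule F A, IsAlgIdeal I → I = ⨆ g, I ⊓ 𝒜.comp g → I = ⊥ ∨ I = ⊤

open Classical in
/-- The canonical decomposition `A ≃ ⨁ A_g`. -/
noncomputable def Grading.dec (𝒜 : Grading F G A) :
    A ≃ₗ[F] DirectSum G fun g => 𝒜.comp g :=
  (LinearEquiv.ofBijective (DirectSum.coeLinearMap 𝒜.comp)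
    (DirectSum.isInternal_submodule_of_iSupIndep_of_iSup_eq_top 𝒜.indep 𝒜.iSup_comp)).symm

open Classical in
theorem Grading.dec_apply (𝒜 : Grading F G A) {g : G} {x : A} (hx : x ∈ 𝒜.comp g) :
    𝒜.dec x = DirectSum.lof F G (fun g => 𝒜.comp g) g ⟨x, hx⟩ := by
  rw [Grading.dec, LinearEquiv.symm_apply_eq]
  exact (DirectSum.coeLinearMap_lof 𝒜.comp g (⟨x, hx⟩ : 𝒜.comp g)).symm

variable [IsScalarTower F A A] [SMulCommClass F A A]

/-- `C(A)_g = {c ∈ C(A) | c A_{g'} ⊆ A_{gg'} for all g'}`. -/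
def centroidComp (𝒜 : Grading F G A) (g : G) : Submodule F (centroid F A) where
  carrier := {c | ∀ g' : G, ∀ x ∈ 𝒜.comp g', c.1 x ∈ 𝒜.comp (g * g')}
  zero_mem' := fun _ _ _ => Submodule.zero_mem _
  add_mem' := fun hc hd g' x hx => Submodule.add_mem _ (hc g' x hx) (hd g' x hx)
  smul_mem' := fun r _ hc g' x hx => Submodule.smul_mem _ r (hc g' x hx)

/-- A graded-central algebra: `C(A)_e = F 1`. -/
def IsGradedCentral (𝒜 : Grading F G A) : Prop :=
  centroidComp 𝒜 1 = Submodule.span F {(1 : centroid F A)}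

/-- A graded-central-simple algebra. -/
def IsGradedCentralSimple (𝒜 : Grading F G A) : Prop :=
  IsGradedSimple 𝒜 ∧ IsGradedCentral 𝒜

/-! ### Cocycle twists -/

open Classical in
/-- The bilinear multiplication of `A^τ`; see `Grading.twistMul_apply` for its value on
homogeneous elements, which determines it. -/
noncomputable def Grading.twistMul (𝒜 : Grading F G A) (τ : Z2Sym G Fˣ) :
    A →ₗ[F] A →ₗ[F] A :=
  (DirectSum.toModule F G (A →ₗ[F] A) fun g =>
    ((DirectSum.toModule F G (A →ₗ[F] A) fun h =>
      ((τ.1 (g, h) : F) • (LinearMap.mul F A).flip) ∘ₗ (𝒜.comp h).subtype) ∘ₗ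
        𝒜.dec.toLinearMap).flip ∘ₗ (𝒜.comp g).subtype) ∘ₗ 𝒜.dec.toLinearMap

/-- `x * y = τ(g, h) xy` for `x ∈ A_g`, `y ∈ A_h`. -/
theorem Grading.twistMul_apply (𝒜 : Grading F G A) (τ : Z2Sym G Fˣ) {g h : G} {x y : A}
    (hx : x ∈ 𝒜.comp g) (hy : y ∈ 𝒜.comp h) :
    𝒜.twistMul τ x y = (τ.1 (g, h) : F) • (x * y) := by
  classical
  simp [Grading.twistMul, 𝒜.dec_apply hx, 𝒜.dec_apply hy, DirectSum.toModule_lof]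

/-- The `τ`-twist `A^τ` of the graded algebra `A`: the same vector space with the multiplication
`x * y = τ(g, h) xy` for `x ∈ A_g`, `y ∈ A_h`. -/
def Twist (_ : Grading F G A) (_ : Z2Sym G Fˣ) : Type _ := A

instance (𝒜 : Grading F G A) (τ : Z2Sym G Fˣ) : AddCommGroup (Twist 𝒜 τ) :=
  inferInstanceAs (AddCommGroup A)

noncomputable instance (𝒜 : Grading F G A) (τ : Z2Sym G Fˣ) :
    NonUnitalNonAssocRing (Twist 𝒜 τ) where
  mul x y := 𝒜.twistMul τ x y
  left_distrib x y z := map_add (𝒜.twistMul τ x) y z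
  right_distrib x y z := LinearMap.map_add₂ (𝒜.twistMul τ) x y z
  zero_mul x := LinearMap.map_zero₂ (𝒜.twistMul τ) x
  mul_zero x := map_zero (𝒜.twistMul τ x)

noncomputable instance (𝒜 : Grading F G A) (τ : Z2Sym G Fˣ) : Module F (Twist 𝒜 τ) :=
  inferInstanceAs (Module F A)

instance (𝒜 : Grading F G A) (τ : Z2Sym G Fˣ) :
    IsScalarTower F (Twist 𝒜 τ) (Twist 𝒜 τ) where
  smul_assoc r x y := LinearMap.map_smul₂ (𝒜.twistMul τ) r x y

instance (𝒜 : Grading F G A) (τ : Z2Sym G Fˣ) :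
    SMulCommClass F (Twist 𝒜 τ) (Twist 𝒜 τ) where
  smul_comm r x y := (map_smul (𝒜.twistMul τ x) r y).symm

/-- The `G`-grading of `A^τ`: the components are those of `A`. -/
noncomputable def Grading.twist (𝒜 : Grading F G A) (τ : Z2Sym G Fˣ) :
    Grading F G (Twist 𝒜 τ) where
  comp := 𝒜.comp
  indep := 𝒜.indep
  iSup_comp := 𝒜.iSup_comp
  mul_mem g h x hx y hy := by
    have e : x * y = 𝒜.twistMul τ x y := rfl
    rw [e, 𝒜.twistMul_apply τ hx hy]
    exact Submodule.smul_mem _ _ (𝒜.mul_mem g h _ hx _ hy)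

end Graded

/-! ### Twisted group algebras -/

/-- The natural grading of the group algebra `F G`, with `(F G)_g = F g`. -/
noncomputable def groupAlgGrading (F G : Type*) [Field F] [CommGroup G] :
    Grading F G (MonoidAlgebra F G) where
  comp g := Submodule.span F {MonoidAlgebra.single g (1 : F)}
  indep := by
    refine iSupIndep_of_proj _
      (fun g => (Finsupp.lapply g ∘ₗ (MonoidAlgebra.coeffLinearEquiv F).toLinearMap :
        MonoidAlgebra F G →ₗ[F] F)) ?_ ?_
    · intro g x hx h0
      obtain ⟨r, rfl⟩ := Submodule.mem_span_singleton.1 hx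
      have : r = 0 := by simpa using h0
      simp [this]
    · intro g h hne x hx
      obtain ⟨r, rfl⟩ := Submodule.mem_span_singleton.1 hx
      simp [Finsupp.single_eq_of_ne hne.symm]
  iSup_comp := by
    rw [eq_top_iff]
    intro x _
    rw [← MonoidAlgebra.sum_coeff_single x]
    refine Submodule.sum_mem _ fun g _ => Submodule.mem_iSup_of_mem g ?_
    exact Submodule.mem_span_singleton.2 ⟨x.coeff g, by simp⟩
  mul_mem g h x hx y hy := by
    obtain ⟨r, rfl⟩ := Submodule.mem_span_singleton.1 hx
    obtain ⟨s, rfl⟩ := Submodule.mem_span_singleton.1 hy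
    exact Submodule.mem_span_singleton.2 ⟨r * s, by simp [MonoidAlgebra.single_mul_single]⟩

/-- The natural `G`-grading of the twisted group algebra `F^τ G = (F G)^τ`. -/
noncomputable abbrev twistedGroupAlgGrading (F : Type*) {G : Type*} [Field F] [CommGroup G]
    (τ : Z2Sym G Fˣ) : Grading F G (Twist (groupAlgGrading F G) τ) :=
  (groupAlgGrading F G).twist τ

/-! ### Loop algebras -/

section Loop

variable {F G A : Type*} [Field F] [CommGroup G] [NonUnitalNonAssocRing A] [Module F A]
  {H : Subgroup G}

/-- The subspace `A_{π(g)} ⊗ g` of `A ⊗ F G`. -/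
noncomputable def loopComp (𝒜 : Grading F (G ⧸ H) A) (g : G) :
    Submodule F (A ⊗[F] MonoidAlgebra F G) :=
  (𝒜.comp (QuotientGroup.mk' H g)).map
    ((TensorProduct.mk F A (MonoidAlgebra F G)).flip (MonoidAlgebra.single g 1))

theorem loopComp_indep (𝒜 : Grading F (G ⧸ H) A) : iSupIndep (loopComp 𝒜) := by
  refine iSupIndep_of_proj _ (fun g => (TensorProduct.rid F A).toLinearMap ∘ₗ
    LinearMap.lTensor A (Finsupp.lapply g ∘ₗ (MonoidAlgebra.coeffLinearEquiv F).toLinearMap :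
      MonoidAlgebra F G →ₗ[F] F)) ?_ ?_
  · rintro g _ ⟨a, -, rfl⟩ h0
    have : a = 0 := by simpa using h0
    simp [this]
  · rintro g h hne _ ⟨a, -, rfl⟩
    simp [Finsupp.single_eq_of_ne hne.symm]

variable [IsScalarTower F A A] [SMulCommClass F A A]

theorem loopComp_mul_mem (𝒜 : Grading F (G ⧸ H) A) (g h : G)
    (x : A ⊗[F] MonoidAlgebra F G) (hx : x ∈ loopComp 𝒜 g)
    (y : A ⊗[F] MonoidAlgebra F G) (hy : y ∈ loopComp 𝒜 h) : x * y ∈ loopComp 𝒜 (g * h) := by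
  obtain ⟨a, ha, rfl⟩ := hx
  obtain ⟨b, hb, rfl⟩ := hy
  refine ⟨a * b, ?_, ?_⟩
  · rw [map_mul]
    exact 𝒜.mul_mem _ _ a ha b hb
  · simp [MonoidAlgebra.single_mul_single]

/-- The loop algebra `L_π(A) = ⨁_{g ∈ G} A_{π(g)} ⊗ g`, a subalgebra of `A ⊗ F G`,
where `π : G → G/H` is the canonical projection. -/
noncomputable def loopAlgebra (𝒜 : Grading F (G ⧸ H) A) :
    NonUnitalSubalgebra F (A ⊗[F] MonoidAlgebra F G) where
  toSubmodule := ⨆ g, loopComp 𝒜 g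
  mul_mem' := by
    intro x y hx hy
    change x ∈ ⨆ g, loopComp 𝒜 g at hx
    change y ∈ ⨆ g, loopComp 𝒜 g at hy
    change x * y ∈ ⨆ g, loopComp 𝒜 g
    induction hx using Submodule.iSup_induction' with
    | zero => rw [zero_mul]; exact Submodule.zero_mem _
    | add u v _ _ hu hv => rw [add_mul]; exact Submodule.add_mem _ hu hv
    | mem g u hu =>
      induction hy using Submodule.iSup_induction' with
      | zero => rw [mul_zero]; exact Submodule.zero_mem _
      | add v w _ _ hv hw => rw [mul_add]; exact Submodule.add_mem _ hv hw
      | mem h v hv => exact Submodule.mem_iSup_of_mem (g * h) (loopComp_mul_mem 𝒜 g h u hu v hv)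

/-- The `G`-grading of the loop algebra, with `L_π(A)_g = A_{π(g)} ⊗ g`. -/
noncomputable def loopGrading (𝒜 : Grading F (G ⧸ H) A) : Grading F G (loopAlgebra 𝒜) where
  comp g := (loopComp 𝒜 g).comap (loopAlgebra 𝒜).toSubmodule.subtype
  indep := by
    have hd := loopComp_indep 𝒜
    intro g
    have h := hd g
    rw [Submodule.disjoint_def] at h ⊢
    intro x hx hx'
    refine Subtype.ext (h _ hx ?_)
    have hle : (⨆ (j) (_ : j ≠ g), (loopComp 𝒜 j).comap (loopAlgebra 𝒜).toSubmodule.subtype) ≤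
        (⨆ (j) (_ : j ≠ g), loopComp 𝒜 j).comap (loopAlgebra 𝒜).toSubmodule.subtype :=
      iSup₂_le fun j hj => Submodule.comap_mono (le_iSup₂_of_le j hj le_rfl)
    exact hle hx'
  iSup_comp := by
    apply Submodule.map_injective_of_injective (loopAlgebra 𝒜).toSubmodule.injective_subtype
    rw [Submodule.map_iSup, Submodule.map_top, Submodule.range_subtype]
    refine iSup_congr fun g => ?_
    rw [Submodule.map_comap_subtype]
    exact inf_eq_right.2 (le_iSup (loopComp 𝒜) g)
  mul_mem g h x hx y hy := loopComp_mul_mem 𝒜 g h x hx y hy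

/-- The `G`-grading of the cocycle twisted loop algebra `L_π^τ(A) = (L_π(A))^τ`. -/
noncomputable abbrev twistedLoopGrading (𝒜 : Grading F (G ⧸ H) A) (τ : Z2Sym G Fˣ) :
    Grading F G (Twist (loopGrading 𝒜) τ) :=
  (loopGrading 𝒜).twist τ

end Loop

/-! ### Symmetric cocycles: normalization, splitting in divisible groups, extension, descent -/

section Cocycles

variable {K M : Type*} [CommGroup K] [CommGroup M]

/-! The centroid C(B) of a graded-simple algebra B is commutative and graded, and its nonzero
homogeneous elements are invertible (`exists_centroid_inv`). Its support H is therefore a subgroup,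
and if C(B)_e consists of scalars, every component is at most one-dimensional. Nonzero elements u_h
of C(B)_h thus multiply by a symmetric cocycle on H. Divisible groups are injective, so this cocycle
extends to some τ on G (`Z2Sym.exists_extend`). Identifying u_h x with τ(h, g) x for x of degree g
collapses B to a G/H-graded algebra A (`IsGradedSimple.exists_isLoopMap`).

The relation between B and A is recorded by a linear map P : B → A that restricts to bijections from
B_g to A_{π(g)} and satisfies P(xy) = τ(g, k) P(x) P(y) for x in B_g and y in B_k. Such a map
determines B up to graded isomorphism, so the arguments use `IsLoopMap` and the tensor product
enters only in `isLoopMap_loopMap`. Homogeneous centroid elements pass through P in both directions: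
d in C(A)_{π(k)} corresponds to c in C(B)_k with P(c x) = τ(k, g) d(P x). If A is central simple,
C(B) thus has a basis z_h, h in H, multiplying by τ, which gives part 2. If conversely B is
graded-central-simple with centroid supported in H, then C(A) consists of scalars. Simplicity of A
without regard to the grading then follows from a minimal-support argument
(`IsGradedSimple.isSimpleAlg`).

For part 3, two presentations of one algebra B have the same H, the support of C(B), and centroid
bases that differ by scalars γ(h). Hence τ₁ and τ₂ differ on H by the coboundary of γ.
`Z2Sym.exists_descend` extends γ to a function δ on G such that the remaining discrepancy is
inflated from a cocycle μ on G/H. Dividing P₂ by δ(g) in degree g then makes it factor through P₁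
and yields the isomorphism from A₁^μ to A₂. The converse reverses this rescaling. -/

theorem Z2Sym.cocycle (σ : Z2Sym K M) (a b c : K) :
    σ.1 (a, b) * σ.1 (a * b, c) = σ.1 (a, b * c) * σ.1 (b, c) := σ.2.1 a b c

theorem Z2Sym.symm (σ : Z2Sym K M) (a b : K) : σ.1 (a, b) = σ.1 (b, a) := σ.2.2 a b

/-- Cocycles are not assumed normalized, so the constant σ(1, 1) has to be carried along, for
instance in the neutral element of `CocycleExt`. -/
theorem Z2Sym.one_left (σ : Z2Sym K M) (a : K) : σ.1 (1, a) = σ.1 (1, 1) := by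
  have h := Z2Sym.cocycle σ 1 1 a
  rw [one_mul, one_mul] at h
  exact (mul_right_cancel h).symm

theorem Z2Sym.one_right (σ : Z2Sym K M) (a : K) : σ.1 (a, 1) = σ.1 (1, 1) := by
  rw [Z2Sym.symm σ, Z2Sym.one_left σ]

/-- The abelian extension of `K` by `M` defined by a symmetric cocycle. -/
@[ext]
structure CocycleExt (σ : Z2Sym K M) where
  /-- the component in `K` -/
  base : K
  /-- the component in `M` -/
  fiber : M

instance (σ : Z2Sym K M) : CommGroup (CocycleExt σ) where
  mul x y := ⟨x.base * y.base, σ.1 (x.base, y.base) * (x.fiber * y.fiber)⟩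
  one := ⟨1, (σ.1 (1, 1))⁻¹⟩
  inv x := ⟨x.base⁻¹, (σ.1 (x.base⁻¹, x.base) * x.fiber * σ.1 (1, 1))⁻¹⟩
  mul_assoc x y z := by
    refine CocycleExt.ext (mul_assoc _ _ _) ?_
    change σ.1 (x.base * y.base, z.base) * (σ.1 (x.base, y.base) * (x.fiber * y.fiber) * z.fiber) =
      σ.1 (x.base, y.base * z.base) * (x.fiber * (σ.1 (y.base, z.base) * (y.fiber * z.fiber)))
    have h := Z2Sym.cocycle σ x.base y.base z.base
    calc _ = (σ.1 (x.base, y.base) * σ.1 (x.base * y.base, z.base)) *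
          (x.fiber * y.fiber * z.fiber) := by ac_rfl
      _ = _ := by rw [h]; ac_rfl
  one_mul x := by
    refine CocycleExt.ext (one_mul _) ?_
    change σ.1 (1, x.base) * ((σ.1 (1, 1))⁻¹ * x.fiber) = x.fiber
    rw [Z2Sym.one_left σ, mul_inv_cancel_left]
  mul_one x := by
    refine CocycleExt.ext (mul_one _) ?_
    change σ.1 (x.base, 1) * (x.fiber * (σ.1 (1, 1))⁻¹) = x.fiber
    rw [Z2Sym.one_right σ, mul_comm x.fiber, mul_inv_cancel_left]
  inv_mul_cancel x := by
    refine CocycleExt.ext (inv_mul_cancel _) ?_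
    change σ.1 (x.base⁻¹, x.base) *
      ((σ.1 (x.base⁻¹, x.base) * x.fiber * σ.1 (1, 1))⁻¹ * x.fiber) = (σ.1 (1, 1))⁻¹
    rw [mul_inv, mul_inv]
    calc _ = (σ.1 (x.base⁻¹, x.base) * (σ.1 (x.base⁻¹, x.base))⁻¹) * (x.fiber⁻¹ * x.fiber) *
          (σ.1 (1, 1))⁻¹ := by ac_rfl
      _ = _ := by simp
  mul_comm x y := by
    refine CocycleExt.ext (mul_comm _ _) ?_
    change σ.1 (x.base, y.base) * (x.fiber * y.fiber) = σ.1 (y.base, x.base) * (y.fiber * x.fiber)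
    rw [Z2Sym.symm σ, mul_comm x.fiber]

/-- The inclusion of the kernel `M` into the extension. -/
def CocycleExt.incl (σ : Z2Sym K M) : M →* CocycleExt σ where
  toFun m := ⟨1, (σ.1 (1, 1))⁻¹ * m⟩
  map_one' := CocycleExt.ext rfl (mul_one _)
  map_mul' m n := by
    refine CocycleExt.ext (one_mul _).symm ?_
    change (σ.1 (1, 1))⁻¹ * (m * n) =
      σ.1 (1, 1) * ((σ.1 (1, 1))⁻¹ * m * ((σ.1 (1, 1))⁻¹ * n))
    rw [mul_assoc (σ.1 (1, 1))⁻¹ m, mul_inv_cancel_left, mul_left_comm]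

theorem CocycleExt.incl_injective (σ : Z2Sym K M) : Function.Injective (CocycleExt.incl σ) :=
  fun _ _ h => mul_left_cancel (congrArg CocycleExt.fiber h)

/-- Every abelian group embeds into a divisible one. -/
theorem exists_embedding_divisible.{u} (M : Type u) [AddCommGroup M] :
    ∃ (D : Type u) (_ : AddCommGroup D) (_ : DivisibleBy D ℤ) (ι : M →+ D),
      Function.Injective ι := by
  -- Evaluation at all characters, into a power of ℚ/ℤ; it is injective because characters separate
  -- points.
  refine ⟨CharacterModule M → AddCircle (1 : ℚ), inferInstance, inferInstance,
    { toFun := fun m c => c m, map_zero' := by ext; simp, map_add' := fun _ _ => by ext; simp },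
    ?_⟩
  rw [injective_iff_map_eq_zero]
  exact fun m hm => CharacterModule.eq_zero_of_character_apply fun c => congrFun hm c

variable {D : Type*} [AddCommGroup D] [DivisibleBy D ℤ]

/-- A symmetric cocycle becomes a coboundary in a divisible group. -/
theorem Z2Sym.exists_split (ι : Additive M →+ D) (σ : Z2Sym K M) :
    ∃ s : K → D, ∀ a b, ι (Additive.ofMul (σ.1 (a, b))) = s a + s b - s (a * b) := by
  -- A divisible group is injective, so ι extends from M to the extension group. There (a, 1)(b, 1)
  -- is the image of σ(a, b) times (ab, 1), so the values of the extended map at the elements (a, 1)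
  -- split σ.
  obtain ⟨f, hf⟩ := (Module.Baer.of_divisible D).extension_property_addMonoidHom
    (MonoidHom.toAdditive (CocycleExt.incl σ)) (CocycleExt.incl_injective σ) ι
  refine ⟨fun a => f (Additive.ofMul ⟨a, 1⟩), fun a b => ?_⟩
  rw [eq_sub_iff_add_eq, ← map_add, ← hf, AddMonoidHom.comp_apply, ← map_add]
  refine congrArg f ?_
  change Additive.ofMul (CocycleExt.incl σ (σ.1 (a, b)) * ⟨a * b, 1⟩) =
    Additive.ofMul ((⟨a, 1⟩ : CocycleExt σ) * ⟨b, 1⟩)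
  refine congrArg _ (CocycleExt.ext (one_mul _) ?_)
  change σ.1 (1, a * b) * ((σ.1 (1, 1))⁻¹ * σ.1 (a, b) * 1) = σ.1 (a, b) * (1 * 1)
  rw [Z2Sym.one_left σ, mul_one, mul_one, mul_one, mul_inv_cancel_left]

/-- A map into a divisible group whose coboundary takes values in `M` defines a cocycle. -/
theorem Z2Sym.exists_of_coboundary {D : Type*} [AddCommGroup D] (ι : Additive M →+ D)
    (hι : Function.Injective ι) (s : K → D)
    (h : ∀ a b, ∃ m : M, ι (Additive.ofMul m) = s a + s b - s (a * b)) :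
    ∃ σ : Z2Sym K M, ∀ a b, ι (Additive.ofMul (σ.1 (a, b))) = s a + s b - s (a * b) := by
  choose t ht using h
  have hinj : Function.Injective fun m : M => ι (Additive.ofMul m) :=
    hι.comp Additive.ofMul.injective
  refine ⟨⟨fun p => t p.1 p.2, fun a b c => hinj ?_, fun a b => hinj ?_⟩, fun a b => ht a b⟩
  · simp only [ofMul_mul, map_add, ht, mul_assoc]
    abel
  · simp only [ht, mul_comm b a]
    abel

end Cocycles

section Extend

variable {G M : Type*} [CommGroup G] [CommGroup M] (H : Subgroup G)

/-- A homomorphism from a subgroup to a divisible group extends to the whole group. -/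
theorem exists_extend_divisible {D : Type*} [AddCommGroup D] [DivisibleBy D ℤ] (f : H → D)
    (hf : ∀ a b, f (a * b) = f a + f b) :
    ∃ f' : G → D, (∀ a b, f' (a * b) = f' a + f' b) ∧ ∀ h : H, f' h = f h := by
  obtain ⟨k, hk⟩ := (Module.Baer.of_divisible D).extension_property_addMonoidHom
    (MonoidHom.toAdditive H.subtype) H.subtype_injective
    (AddMonoidHom.mk' (fun x : Additive H => f x.toMul) fun a b => hf a.toMul b.toMul)
  exact ⟨fun g => k (Additive.ofMul g), fun a b => map_add k (Additive.ofMul a) (Additive.ofMul b),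
    fun h => DFunLike.congr_fun hk (Additive.ofMul h)⟩

/-- Every symmetric cocycle on a subgroup extends to the whole group. -/
theorem Z2Sym.exists_extend (σ : Z2Sym H M) :
    ∃ τ : Z2Sym G M, ∀ a b : H, τ.1 (a, b) = σ.1 (a, b) := by
  classical
  obtain ⟨D, _, _, ι, hι⟩ := exists_embedding_divisible (Additive M)
  obtain ⟨s, hs⟩ := Z2Sym.exists_split ι σ
  -- The coboundary of s is M-valued, so s induces a homomorphism from H to D/M, which extends to χ
  -- on G since D/M is divisible. A lift t of χ that equals s on H has an M-valued coboundary, and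
  -- this is the required cocycle.
  let _ : DivisibleBy (D ⧸ ι.range) ℤ :=
    Function.Surjective.divisibleBy (QuotientAddGroup.mk' ι.range)
      (QuotientAddGroup.mk'_surjective _) (fun a n => map_zsmul _ n a)
  let q : D →+ D ⧸ ι.range := QuotientAddGroup.mk' ι.range
  have hq : ∀ d : D, q d = 0 ↔ ∃ m : M, ι (Additive.ofMul m) = d := fun d =>
    (QuotientAddGroup.eq_zero_iff d).trans ⟨fun ⟨m, hm⟩ => ⟨m.toMul, hm⟩, fun ⟨m, hm⟩ => ⟨_, hm⟩⟩
  obtain ⟨χ, hχ, hχs⟩ := exists_extend_divisible H (fun h => q (s h)) (fun a b => by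
    have : q (s a + s b - s (a * b)) = 0 := (hq _).2 ⟨_, hs a b⟩
    rw [map_sub, map_add, sub_eq_zero] at this
    exact this.symm)
  let t : G → D := fun g =>
    if h : g ∈ H then s ⟨g, h⟩ else (QuotientAddGroup.mk'_surjective ι.range (χ g)).choose
  have htH : ∀ h : H, t h = s h := fun h => dif_pos h.2
  have ht : ∀ g, q (t g) = χ g := by
    intro g
    by_cases h : g ∈ H
    · rw [htH ⟨g, h⟩]
      exact (hχs ⟨g, h⟩).symm
    · simp only [t, dif_neg h]
      exact (QuotientAddGroup.mk'_surjective ι.range (χ g)).choose_spec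
  obtain ⟨τ, hτ⟩ := Z2Sym.exists_of_coboundary ι hι t (fun a b => (hq _).1 (by
    rw [map_sub, map_add, ht, ht, ht, hχ, sub_self]))
  refine ⟨τ, fun a b => Additive.ofMul.injective (hι ?_)⟩
  rw [hτ, hs, htH, htH, ← H.coe_mul, htH]

/-- A set-theoretic section of `G → G ⧸ H` that preserves the neutral element. -/
theorem exists_section_one :
    ∃ ξ : G ⧸ H → G, (∀ a, (QuotientGroup.mk' H (ξ a)) = a) ∧ ξ 1 = 1 := by
  classical
  refine ⟨fun a => if a = 1 then 1 else a.out, fun a => ?_, if_pos rfl⟩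
  by_cases h : a = 1
  · simp [h]
  · simp [h]

/-- If `τ₁` and `τ₂` differ on `H` by the coboundary of `γ`, then they differ on `G` by the
product of a cocycle inflated from `G ⧸ H` and the coboundary of an extension of `γ`. -/
theorem Z2Sym.exists_descend (τ₁ τ₂ : Z2Sym G M) (γ : H → M)
    (hγ : ∀ a b : H, τ₁.1 (a, b) * γ (a * b) = τ₂.1 (a, b) * (γ a * γ b)) :
    ∃ (δ : G → M) (μ : Z2Sym (G ⧸ H) M), (∀ h : H, δ h = γ h) ∧
      ∀ a b : G, τ₁.1 (a, b) * δ (a * b) =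
        μ.1 (QuotientGroup.mk' H a, QuotientGroup.mk' H b) * τ₂.1 (a, b) * (δ a * δ b) := by
  obtain ⟨D, _, _, ι, hι⟩ := exists_embedding_divisible (Additive M)
  obtain ⟨s, hs⟩ := Z2Sym.exists_split ι (τ₁ * τ₂⁻¹)
  have hs' : ∀ a b, ι (Additive.ofMul (τ₁.1 (a, b))) - ι (Additive.ofMul (τ₂.1 (a, b))) =
      s a + s b - s (a * b) := fun a b => by
    rw [← hs, ← map_sub]; rw [sub_eq_add_neg]; rfl
  have hγ' : ∀ a b : H, ι (Additive.ofMul (τ₁.1 (a, b))) - ι (Additive.ofMul (τ₂.1 (a, b))) =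
      ι (Additive.ofMul (γ a)) + ι (Additive.ofMul (γ b)) - ι (Additive.ofMul (γ (a * b))) := by
    intro a b
    have := congrArg (fun m => ι (Additive.ofMul m)) (hγ a b)
    simp only [ofMul_mul, map_add] at this
    rw [sub_eq_sub_iff_add_eq_add, this]
    abel
  -- On H the functions s and ιγ have the same coboundary, so their difference is a homomorphism.
  -- Subtracting its extension χ from s leaves the coboundary unchanged and makes the result equal
  -- to ιγ on H.
  obtain ⟨χ, hχ, hχs⟩ := exists_extend_divisible H (fun h => s h - ι (Additive.ofMul (γ h)))
    (fun a b => by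
      have h1 := hs' a b
      rw [hγ'] at h1
      have h2 : s (a * b) = s a + s b - (ι (Additive.ofMul (γ a)) + ι (Additive.ofMul (γ b)) -
        ι (Additive.ofMul (γ (a * b)))) := by rw [h1]; abel
      rw [H.coe_mul, h2]
      abel)
  obtain ⟨ξ, hξ, hξ1⟩ := exists_section_one H
  let t : G → D := fun g => s g - χ g
  have htH : ∀ h : H, t h = ι (Additive.ofMul (γ h)) := fun h => by
    simp only [t, hχs]; abel
  have ht : ∀ a b, ι (Additive.ofMul (τ₁.1 (a, b))) - ι (Additive.ofMul (τ₂.1 (a, b))) =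
      t a + t b - t (a * b) := fun a b => by
    rw [hs']; simp only [t, hχ]; abel
  have hmem : ∀ g : G, (ξ (QuotientGroup.mk' H g))⁻¹ * g ∈ H := fun g =>
    QuotientGroup.eq.1 (hξ _)
  -- Since g is the product of ξ(π(g)) and an element h of H, and both t(h) and the coboundary of t
  -- are M-valued, t(g) and t(ξ(π(g))) differ by an element of M. The correction t(1), together with
  -- ξ(1) = 1, makes δ equal to γ on H.
  have hδ : ∀ g : G, ∃ m : M,
      ι (Additive.ofMul m) = t g - (t (ξ (QuotientGroup.mk' H g)) - t 1) := by
    intro g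
    have h1 := ht (ξ (QuotientGroup.mk' H g)) ((ξ (QuotientGroup.mk' H g))⁻¹ * g)
    rw [mul_inv_cancel_left, htH ⟨_, hmem g⟩] at h1
    refine ⟨γ 1 * γ ⟨_, hmem g⟩ * τ₂.1 (ξ (QuotientGroup.mk' H g), (ξ (QuotientGroup.mk' H g))⁻¹ * g) *
      (τ₁.1 (ξ (QuotientGroup.mk' H g), (ξ (QuotientGroup.mk' H g))⁻¹ * g))⁻¹, ?_⟩
    have ht1 := htH 1
    rw [Subgroup.coe_one] at ht1
    simp only [ofMul_mul, ofMul_inv, map_add, map_neg, ← ht1]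
    have h2 : t g = t (ξ (QuotientGroup.mk' H g)) + ι (Additive.ofMul (γ ⟨_, hmem g⟩)) -
      (ι (Additive.ofMul (τ₁.1 (ξ (QuotientGroup.mk' H g), (ξ (QuotientGroup.mk' H g))⁻¹ * g))) -
      ι (Additive.ofMul (τ₂.1 (ξ (QuotientGroup.mk' H g), (ξ (QuotientGroup.mk' H g))⁻¹ * g)))) := by
      rw [h1]; abel
    conv_rhs => rw [h2]
    abel
  choose δ hδ using hδ
  -- The function t is the sum of ιδ and the inflation of a ↦ t(ξ(a)) - t(1). Removing the
  -- coboundary of δ from τ₁/τ₂ therefore leaves an M-valued cocycle inflated from G/H, which is μ.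
  have key : ∀ a b : G, ι (Additive.ofMul (τ₁.1 (a, b) * (τ₂.1 (a, b))⁻¹ *
      (δ (a * b) * (δ a)⁻¹ * (δ b)⁻¹))) = (t (ξ (QuotientGroup.mk' H a)) - t 1) +
        (t (ξ (QuotientGroup.mk' H b)) - t 1) - (t (ξ (QuotientGroup.mk' H (a * b))) - t 1) := by
    intro a b
    simp only [ofMul_mul, ofMul_inv, map_add, map_neg, hδ]
    rw [← sub_eq_add_neg (ι _), ht]
    abel
  obtain ⟨μ, hμ⟩ := Z2Sym.exists_of_coboundary ι hι (fun a => t (ξ a) - t 1) (fun a b => by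
    refine ⟨_, (key (ξ a) (ξ b)).trans ?_⟩
    rw [map_mul, hξ, hξ])
  refine ⟨δ, μ, fun h => Additive.ofMul.injective (hι ?_), fun a b => ?_⟩
  · have : QuotientGroup.mk' H (h : G) = 1 := (QuotientGroup.eq_one_iff _).2 h.2
    rw [hδ, this, hξ1, htH, sub_self, sub_zero]
  · have h1 : μ.1 (QuotientGroup.mk' H a, QuotientGroup.mk' H b) =
        τ₁.1 (a, b) * (τ₂.1 (a, b))⁻¹ * (δ (a * b) * (δ a)⁻¹ * (δ b)⁻¹) :=
      Additive.ofMul.injective (hι (by rw [hμ, key, map_mul]))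
    rw [h1]
    calc τ₁.1 (a, b) * δ (a * b) = τ₁.1 (a, b) * δ (a * b) * ((τ₂.1 (a, b))⁻¹ * τ₂.1 (a, b)) *
          ((δ a)⁻¹ * δ a) * ((δ b)⁻¹ * δ b) := by simp
      _ = _ := by ac_rfl

end Extend

/-! ### Linear algebra of gradings -/

section GradingTools

variable {F G A V : Type*} [Field F] [CommGroup G] [NonUnitalNonAssocRing A] [Module F A]
  [AddCommGroup V] [Module F V]

open Classical in
/-- The linear map given by `f g` on the component of degree `g`. -/
noncomputable def Grading.lift (𝒜 : Grading F G A) (f : G → A →ₗ[F] V) : A →ₗ[F] V :=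
  (DirectSum.toModule F G V fun g => f g ∘ₗ (𝒜.comp g).subtype) ∘ₗ 𝒜.dec.toLinearMap

theorem Grading.lift_apply (𝒜 : Grading F G A) (f : G → A →ₗ[F] V) {g : G} {x : A}
    (hx : x ∈ 𝒜.comp g) : 𝒜.lift f x = f g x := by
  classical
  simp [Grading.lift, 𝒜.dec_apply hx, DirectSum.toModule_lof]

/-- The projection onto the component of degree `g`. -/
noncomputable def Grading.proj (𝒜 : Grading F G A) (g : G) : A →ₗ[F] A :=
  (𝒜.comp g).subtype ∘ₗ DirectSum.component F G (fun g => 𝒜.comp g) g ∘ₗ 𝒜.dec.toLinearMap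

theorem Grading.proj_mem (𝒜 : Grading F G A) (g : G) (x : A) : 𝒜.proj g x ∈ 𝒜.comp g :=
  Subtype.coe_prop _

theorem Grading.proj_of_mem (𝒜 : Grading F G A) {g : G} {x : A} (hx : x ∈ 𝒜.comp g) :
    𝒜.proj g x = x := by
  classical
  simp [Grading.proj, 𝒜.dec_apply hx, DirectSum.component.lof_self]

theorem Grading.proj_of_mem_ne (𝒜 : Grading F G A) {g h : G} (hne : h ≠ g) {x : A}
    (hx : x ∈ 𝒜.comp h) : 𝒜.proj g x = 0 := by
  classical
  simp [Grading.proj, 𝒜.dec_apply hx, DirectSum.component.of, hne]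

theorem Grading.ext_proj (𝒜 : Grading F G A) {x y : A} (h : ∀ g, 𝒜.proj g x = 𝒜.proj g y) :
    x = y :=
  𝒜.dec.injective (DFinsupp.ext fun g => Subtype.ext (h g))

theorem Grading.finite_proj (𝒜 : Grading F G A) (x : A) : {g | 𝒜.proj g x ≠ 0}.Finite := by
  classical
  refine Set.Finite.subset (DFinsupp.support (𝒜.dec x)).finite_toSet fun g hg => ?_
  rw [Finset.mem_coe, DFinsupp.mem_support_iff]
  intro h0
  exact hg (congrArg Subtype.val h0)

@[elab_as_elim]
theorem Grading.induction (𝒜 : Grading F G A) {p : A → Prop} (x : A)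
    (hom : ∀ g, ∀ x ∈ 𝒜.comp g, p x) (zero : p 0) (add : ∀ x y, p x → p y → p (x + y)) : p x :=
  Submodule.iSup_induction 𝒜.comp (motive := p)
    (𝒜.iSup_comp.symm ▸ Submodule.mem_top : x ∈ ⨆ g, 𝒜.comp g) hom zero add

theorem Grading.hom_ext (𝒜 : Grading F G A) {f f' : A →ₗ[F] V}
    (h : ∀ g, ∀ x ∈ 𝒜.comp g, f x = f' x) : f = f' := by
  ext x
  induction x using 𝒜.induction with
  | hom g x hx => exact h g x hx
  | zero => simp
  | add x y hx hy => simp [hx, hy]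

theorem Grading.exists_homogeneous_ne_zero (𝒜 : Grading F G A) {x : A} (hx : x ≠ 0) :
    ∃ g, 𝒜.proj g x ≠ 0 := by
  by_contra! h
  exact hx (𝒜.ext_proj fun g => by rw [h, map_zero])

theorem Grading.exists_homogeneous_mul_ne_zero (𝒜 : Grading F G A) {x y : A} (hxy : x * y ≠ 0) :
    ∃ g h, ∃ u ∈ 𝒜.comp g, ∃ v ∈ 𝒜.comp h, u * v ≠ 0 := by
  by_contra! h
  refine hxy ?_
  induction x using 𝒜.induction with
  | zero => simp
  | add x x' hx hx' =>
    by_cases h1 : x * y = 0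
    · by_cases h2 : x' * y = 0
      · rw [add_mul, h1, h2, add_zero]
      · exact absurd (hx' h2) h2
    · exact absurd (hx h1) h1
  | hom g x hx =>
    induction y using 𝒜.induction with
    | zero => simp
    | add y y' hy hy' =>
      by_cases h1 : x * y = 0
      · by_cases h2 : x * y' = 0
        · rw [mul_add, h1, h2, add_zero]
        · exact absurd (hy' h2) h2
      · exact absurd (hy h1) h1
    | hom k y hy => exact h g k x hx y hy

theorem Grading.proj_mul_right (𝒜 : Grading F G A) (g : G) {k : G} (x : A) {y : A}
    (hy : y ∈ 𝒜.comp k) : 𝒜.proj (g * k) (x * y) = 𝒜.proj g x * y := by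
  induction x using 𝒜.induction with
  | zero => simp
  | add x x' hx hx' => simp [add_mul, hx, hx']
  | hom l x hx =>
    by_cases hl : l = g
    · subst hl
      rw [𝒜.proj_of_mem hx, 𝒜.proj_of_mem (𝒜.mul_mem _ _ _ hx _ hy)]
    · rw [𝒜.proj_of_mem_ne hl hx, zero_mul,
        𝒜.proj_of_mem_ne (fun h => hl (mul_right_cancel h)) (𝒜.mul_mem _ _ _ hx _ hy)]

theorem Grading.proj_mul_left (𝒜 : Grading F G A) (g : G) {k : G} {x : A} (y : A)
    (hx : x ∈ 𝒜.comp k) : 𝒜.proj (k * g) (x * y) = x * 𝒜.proj g y := by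
  induction y using 𝒜.induction with
  | zero => simp
  | add y y' hy hy' => simp [mul_add, hy, hy']
  | hom l y hy =>
    by_cases hl : l = g
    · subst hl
      rw [𝒜.proj_of_mem hy, 𝒜.proj_of_mem (𝒜.mul_mem _ _ _ hx _ hy)]
    · rw [𝒜.proj_of_mem_ne hl hy, mul_zero,
        𝒜.proj_of_mem_ne (fun h => hl (mul_left_cancel h)) (𝒜.mul_mem _ _ _ hx _ hy)]

/-- A subspace spanned by homogeneous subspaces contains its homogeneous components. -/
theorem Grading.proj_mem_of_mem_iSup (𝒜 : Grading F G A) (K : G → Submodule F A)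
    (hK : ∀ g, K g ≤ 𝒜.comp g) {x : A} (hx : x ∈ ⨆ g, K g) (g : G) : 𝒜.proj g x ∈ K g := by
  induction hx using Submodule.iSup_induction' with
  | zero => simp
  | add x y _ _ hx hy => rw [map_add]; exact Submodule.add_mem _ hx hy
  | mem k x hx =>
    by_cases h : k = g
    · subst h
      rwa [𝒜.proj_of_mem (hK _ hx)]
    · rw [𝒜.proj_of_mem_ne h (hK _ hx)]
      exact Submodule.zero_mem _

/-- A linear map that is injective on a subspace has a linear left inverse there. -/
theorem exists_leftInverse_on {F V W : Type*} [Field F] [AddCommGroup V] [Module F V]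
    [AddCommGroup W] [Module F W] (f : V →ₗ[F] W) (S : Submodule F V)
    (h : ∀ x ∈ S, f x = 0 → x = 0) : ∃ r : W →ₗ[F] V, ∀ x ∈ S, r (f x) = x := by
  obtain ⟨r, hr⟩ := (f ∘ₗ S.subtype).exists_leftInverse_of_injective
    (LinearMap.ker_eq_bot'.2 fun x hx => Subtype.ext (h x x.2 hx))
  exact ⟨S.subtype ∘ₗ r, fun x hx => congrArg Subtype.val (LinearMap.congr_fun hr ⟨x, hx⟩)⟩

end GradingTools

/-! ### Graded ideals and graded simplicity -/

section GradedSimple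

variable {F G A : Type*} [Field F] [CommGroup G] [NonUnitalNonAssocRing A] [Module F A]

/-- A family of subspaces of the components that spans a graded ideal. -/
structure Grading.IsIdealFamily (𝒜 : Grading F G A) (K : G → Submodule F A) : Prop where
  le : ∀ g, K g ≤ 𝒜.comp g
  mul_left : ∀ g h, ∀ x ∈ K g, ∀ a ∈ 𝒜.comp h, a * x ∈ K (h * g)
  mul_right : ∀ g h, ∀ x ∈ K g, ∀ a ∈ 𝒜.comp h, x * a ∈ K (g * h)

theorem Grading.IsIdealFamily.isAlgIdeal {𝒜 : Grading F G A} {K : G → Submodule F A}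
    (hK : 𝒜.IsIdealFamily K) : IsAlgIdeal (⨆ g, K g) := by
  intro x hx a
  induction hx using Submodule.iSup_induction' with
  | zero => simp
  | add x y _ _ hx hy =>
    rw [mul_add, add_mul]
    exact ⟨Submodule.add_mem _ hx.1 hy.1, Submodule.add_mem _ hx.2 hy.2⟩
  | mem g x hx =>
    induction a using 𝒜.induction with
    | zero => simp
    | add a b ha hb =>
      rw [mul_add, add_mul]
      exact ⟨Submodule.add_mem _ ha.1 hb.1, Submodule.add_mem _ ha.2 hb.2⟩
    | hom h a ha =>
      exact ⟨Submodule.mem_iSup_of_mem _ (hK.mul_left g h x hx a ha),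
        Submodule.mem_iSup_of_mem _ (hK.mul_right g h x hx a ha)⟩

theorem IsAlgIdeal.isIdealFamily {I : Submodule F A} (hI : IsAlgIdeal I) (𝒜 : Grading F G A) :
    𝒜.IsIdealFamily fun g => I ⊓ 𝒜.comp g where
  le _ := inf_le_right
  mul_left _ _ x hx a ha := ⟨(hI x hx.1 a).1, 𝒜.mul_mem _ _ _ ha _ hx.2⟩
  mul_right _ _ x hx a ha := ⟨(hI x hx.1 a).2, 𝒜.mul_mem _ _ _ hx.2 _ ha⟩

/-- In a graded-simple algebra a nonzero family as above consists of the full components. -/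
theorem IsGradedSimple.le_of_isIdealFamily {𝒜 : Grading F G A} (h𝒜 : IsGradedSimple 𝒜)
    {K : G → Submodule F A} (hK : 𝒜.IsIdealFamily K) {g₀ : G} {x : A} (hx : x ∈ K g₀)
    (hx0 : x ≠ 0) (g : G) : 𝒜.comp g ≤ K g := by
  have hgr : (⨆ g, K g) = ⨆ g, (⨆ g, K g) ⊓ 𝒜.comp g :=
    le_antisymm (iSup_mono fun g => le_inf (le_iSup K g) (hK.le g))
      (iSup_le fun g => inf_le_left)
  rcases h𝒜.2.2 _ hK.isAlgIdeal hgr with h | h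
  · exact absurd ((Submodule.mem_bot F).1 (h ▸ Submodule.mem_iSup_of_mem g₀ hx)) hx0
  · intro y hy
    rw [← 𝒜.proj_of_mem hy]
    exact 𝒜.proj_mem_of_mem_iSup K hK.le (h ▸ Submodule.mem_top) g

/-- The span of the products of homogeneous elements whose degrees have product `g`. -/
def Grading.prodSpan (𝒜 : Grading F G A) (g : G) : Submodule F A :=
  Submodule.span F {z | ∃ a b, a * b = g ∧ ∃ x ∈ 𝒜.comp a, ∃ y ∈ 𝒜.comp b, z = x * y}

theorem Grading.prodSpan_le (𝒜 : Grading F G A) (g : G) : 𝒜.prodSpan g ≤ 𝒜.comp g := by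
  refine Submodule.span_le.2 ?_
  rintro _ ⟨a, b, rfl, x, hx, y, hy, rfl⟩
  exact 𝒜.mul_mem _ _ _ hx _ hy

theorem Grading.isIdealFamily_prodSpan (𝒜 : Grading F G A) : 𝒜.IsIdealFamily 𝒜.prodSpan where
  le := 𝒜.prodSpan_le
  mul_left g h x hx a ha := Submodule.subset_span ⟨h, g, rfl, a, ha, x, 𝒜.prodSpan_le _ hx, rfl⟩
  mul_right g h x hx a ha := Submodule.subset_span ⟨g, h, rfl, x, 𝒜.prodSpan_le _ hx, a, ha, rfl⟩

theorem IsGradedSimple.exists_mul_ne_zero {𝒜 : Grading F G A} (h𝒜 : IsGradedSimple 𝒜) :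
    ∃ x y : A, x * y ≠ 0 := by
  by_contra! h
  obtain ⟨hnt, hspan, -⟩ := h𝒜
  refine bot_ne_top (α := Submodule F A) (hspan ▸ (eq_comm.1 (Submodule.span_eq_bot.2 ?_)))
  rintro _ ⟨x, y, rfl⟩
  exact h x y

theorem IsGradedSimple.exists_homogeneous {𝒜 : Grading F G A} (h𝒜 : IsGradedSimple 𝒜) :
    ∃ g, ∃ x ∈ 𝒜.comp g, x ≠ 0 := by
  obtain ⟨x, y, h⟩ := h𝒜.exists_mul_ne_zero
  obtain ⟨g, hg⟩ := 𝒜.exists_homogeneous_ne_zero h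
  exact ⟨g, _, 𝒜.proj_mem g _, hg⟩

/-- In a graded-simple algebra each component is spanned by products of homogeneous elements. -/
theorem IsGradedSimple.comp_le_prodSpan {𝒜 : Grading F G A} (h𝒜 : IsGradedSimple 𝒜) (g : G) :
    𝒜.comp g ≤ 𝒜.prodSpan g := by
  obtain ⟨x, y, hxy⟩ := h𝒜.exists_mul_ne_zero
  obtain ⟨a, b, u, hu, v, hv, huv⟩ := 𝒜.exists_homogeneous_mul_ne_zero hxy
  exact h𝒜.le_of_isIdealFamily 𝒜.isIdealFamily_prodSpan
    (Submodule.subset_span ⟨a, b, rfl, u, hu, v, hv, rfl⟩) huv g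

/-- A criterion for graded simplicity in terms of families of homogeneous subspaces. -/
theorem isGradedSimple_of_isIdealFamily (𝒜 : Grading F G A) (hmul : ∃ x y : A, x * y ≠ 0)
    (h : ∀ K, 𝒜.IsIdealFamily K → ∀ g₀, ∀ x ∈ K g₀, x ≠ 0 → ∀ g, 𝒜.comp g ≤ K g) :
    IsGradedSimple 𝒜 := by
  obtain ⟨x, y, hxy⟩ := hmul
  refine ⟨⟨x * y, 0, hxy⟩, ?_, fun I hI hgr => ?_⟩
  · obtain ⟨a, b, u, hu, v, hv, huv⟩ := 𝒜.exists_homogeneous_mul_ne_zero hxy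
    rw [eq_top_iff, ← 𝒜.iSup_comp]
    refine iSup_le fun g => (h _ 𝒜.isIdealFamily_prodSpan _ _
      (Submodule.subset_span ⟨a, b, rfl, u, hu, v, hv, rfl⟩) huv g).trans (Submodule.span_mono ?_)
    rintro _ ⟨-, -, -, x, -, y, -, rfl⟩
    exact ⟨x, y, rfl⟩
  · by_cases h0 : ∃ g, ∃ x ∈ I ⊓ 𝒜.comp g, x ≠ 0
    · obtain ⟨g₀, x, hx, hx0⟩ := h0
      refine Or.inr (eq_top_iff.2 ?_)
      rw [← 𝒜.iSup_comp]
      exact iSup_le fun g => (h _ (hI.isIdealFamily 𝒜) g₀ x hx hx0 g).trans inf_le_left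
    · push Not at h0
      left
      rw [hgr, eq_bot_iff]
      exact iSup_le fun g x hx => (Submodule.mem_bot F).2 (h0 g x hx)

/-- A simple algebra with a grading is graded-simple. -/
theorem IsSimpleAlg.isGradedSimple (h : IsSimpleAlg F A) (𝒜 : Grading F G A) :
    IsGradedSimple 𝒜 := by
  refine isGradedSimple_of_isIdealFamily 𝒜 h.1 fun K hK g₀ x hx hx0 g y hy => ?_
  rcases h.2 _ hK.isAlgIdeal with h | h
  · exact absurd ((Submodule.mem_bot F).1 (h ▸ Submodule.mem_iSup_of_mem g₀ hx)) hx0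
  · rw [← 𝒜.proj_of_mem hy]
    exact 𝒜.proj_mem_of_mem_iSup K hK.le (h ▸ Submodule.mem_top) g

end GradedSimple

/-! ### The centroid of a graded-simple algebra -/

section Centroid

variable {F G A : Type*} [Field F] [CommGroup G] [NonUnitalNonAssocRing A] [Module F A]
  [IsScalarTower F A A] [SMulCommClass F A A]

theorem mem_centroid_of_homogeneous (𝒜 : Grading F G A) (c : A →ₗ[F] A)
    (h : ∀ g k, ∀ x ∈ 𝒜.comp g, ∀ y ∈ 𝒜.comp k, c (x * y) = c x * y ∧ c (x * y) = x * c y) :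
    c ∈ centroid F A := by
  intro x y
  induction x using 𝒜.induction with
  | zero => simp
  | add x x' hx hx' =>
    rw [add_mul, map_add, map_add, add_mul, add_mul, ← hx.1, ← hx'.1, ← hx.2, ← hx'.2]
    exact ⟨rfl, rfl⟩
  | hom g x hx =>
    induction y using 𝒜.induction with
    | zero => simp
    | add y y' hy hy' =>
      rw [mul_add, map_add, map_add, mul_add, mul_add, ← hy.1, ← hy'.1, ← hy.2, ← hy'.2]
      exact ⟨rfl, rfl⟩
    | hom k y hy => exact h g k x hx y hy

theorem centroid.map_mul_left (c : centroid F A) (x y : A) : c.1 (x * y) = c.1 x * y :=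
  (c.2 x y).1

theorem centroid.map_mul_right (c : centroid F A) (x y : A) : c.1 (x * y) = x * c.1 y :=
  (c.2 x y).2

theorem one_mem_centroidComp (𝒜 : Grading F G A) : (1 : centroid F A) ∈ centroidComp 𝒜 1 :=
  fun g' x hx => by rw [one_mul]; exact hx

theorem mul_mem_centroidComp {𝒜 : Grading F G A} {g h : G} {c d : centroid F A}
    (hc : c ∈ centroidComp 𝒜 g) (hd : d ∈ centroidComp 𝒜 h) :
    c * d ∈ centroidComp 𝒜 (g * h) := fun g' x hx => by
  rw [mul_assoc]
  exact hc _ _ (hd _ _ hx)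

namespace IsGradedSimple

variable {𝒜 : Grading F G A} (h𝒜 : IsGradedSimple 𝒜)
include h𝒜

/-- An element of the centroid that kills a nonzero homogeneous element is zero. -/
theorem centroid_eq_zero {k : G} {c : centroid F A} {x : A} (hx : x ∈ 𝒜.comp k) (hx0 : x ≠ 0) (h : c.1 x = 0) : c = 0 := by
  -- As c need not be homogeneous, its kernel need not be graded; its intersections with the
  -- components still form an ideal family.
  have hK : 𝒜.IsIdealFamily fun l => 𝒜.comp l ⊓ LinearMap.ker c.1 := by
    refine ⟨fun _ => inf_le_left, fun l m u hu a ha => ⟨𝒜.mul_mem _ _ _ ha _ hu.1, ?_⟩,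
      fun l m u hu a ha => ⟨𝒜.mul_mem _ _ _ hu.1 _ ha, ?_⟩⟩
    · exact LinearMap.mem_ker.2 ((centroid.map_mul_right c a u).trans (by
        rw [LinearMap.mem_ker.1 hu.2, mul_zero]))
    · exact LinearMap.mem_ker.2 ((centroid.map_mul_left c u a).trans (by
        rw [LinearMap.mem_ker.1 hu.2, zero_mul]))
  refine Subtype.ext (𝒜.hom_ext fun l y hy => ?_)
  exact LinearMap.mem_ker.1 (h𝒜.le_of_isIdealFamily hK (g₀ := k) ⟨hx, h⟩ hx0 l hy).2

/-- The image of c is a graded ideal, nonzero because c kills no nonzero homogeneous element, hence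
everything. -/
theorem exists_preimage {g k : G} {c : centroid F A} (hc : c ∈ centroidComp 𝒜 g) (hc0 : c ≠ 0)
    {y : A} (hy : y ∈ 𝒜.comp (g * k)) : ∃ x ∈ 𝒜.comp k, c.1 x = y := by
  have hK : 𝒜.IsIdealFamily fun l => (𝒜.comp (g⁻¹ * l)).map c.1 := by
    refine ⟨fun l => ?_, ?_, ?_⟩
    · rintro _ ⟨x, hx, rfl⟩
      simpa using hc _ x hx
    · rintro l m _ ⟨x, hx, rfl⟩ a ha
      refine ⟨a * x, ?_, centroid.map_mul_right c a x⟩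
      rw [mul_left_comm]
      exact 𝒜.mul_mem _ _ _ ha _ hx
    · rintro l m _ ⟨x, hx, rfl⟩ a ha
      refine ⟨x * a, ?_, centroid.map_mul_left c x a⟩
      rw [← mul_assoc]
      exact 𝒜.mul_mem _ _ _ hx _ ha
  obtain ⟨l, x, hx, hx0⟩ := h𝒜.exists_homogeneous
  have := h𝒜.le_of_isIdealFamily hK (g₀ := g * l)
    ⟨x, by simpa using hx, rfl⟩ (fun h0 => hc0 (h𝒜.centroid_eq_zero hx hx0 h0)) (g * k) hy
  simpa using this

/-- Nonzero homogeneous elements of the centroid are invertible. -/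
theorem exists_centroid_inv {g : G} {c : centroid F A} (hc : c ∈ centroidComp 𝒜 g)
    (hc0 : c ≠ 0) : ∃ d ∈ centroidComp 𝒜 g⁻¹, d * c = 1 ∧ c * d = 1 := by
  have hinj : ∀ k, ∀ x ∈ 𝒜.comp k, c.1 x = 0 → x = 0 := fun k x hx h => by
    by_contra hx0
    exact hc0 (h𝒜.centroid_eq_zero hx hx0 h)
  -- Each restriction of c from the component of degree k to that of degree gk is bijective; the
  -- inverse is assembled degree by degree.
  choose r hr using fun k => exists_leftInverse_on c.1 (𝒜.comp k) (hinj k)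
  let d : A →ₗ[F] A := 𝒜.lift fun k => r (g⁻¹ * k)
  have hd : ∀ k, ∀ x ∈ 𝒜.comp k, d (c.1 x) = x := fun k x hx => by
    have := 𝒜.lift_apply (fun k => r (g⁻¹ * k)) (hc _ x hx)
    rw [inv_mul_cancel_left, hr _ _ hx] at this
    exact this
  have hcd : ∀ k, ∀ y ∈ 𝒜.comp k, ∃ x ∈ 𝒜.comp (g⁻¹ * k), c.1 x = y := fun k y hy =>
    h𝒜.exists_preimage hc hc0 (by simpa using hy)
  have hdc : d ∈ centroid F A := by
    refine mem_centroid_of_homogeneous 𝒜 d fun k l y hy z hz => ?_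
    obtain ⟨x, hx, rfl⟩ := hcd k y hy
    refine ⟨?_, ?_⟩
    · rw [← centroid.map_mul_left, hd _ _ hx, hd _ _ (𝒜.mul_mem _ _ _ hx _ hz)]
    · obtain ⟨w, hw, rfl⟩ := hcd l z hz
      rw [← centroid.map_mul_right, hd _ _ hw]
      exact hd _ _ (𝒜.mul_mem _ _ _ hy _ hw)
  refine ⟨⟨d, hdc⟩, fun k y hy => ?_, ?_, ?_⟩
  · obtain ⟨x, hx, rfl⟩ := hcd k y hy
    change d (c.1 x) ∈ _
    rwa [hd _ _ hx]
  · exact Subtype.ext (𝒜.hom_ext fun k x hx => hd k x hx)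
  · refine Subtype.ext (𝒜.hom_ext fun k y hy => ?_)
    obtain ⟨x, hx, rfl⟩ := hcd k y hy
    exact congrArg c.1 (hd _ _ hx)

theorem centroid_mul_ne_zero {g : G} {c d : centroid F A} (hc : c ∈ centroidComp 𝒜 g)
    (hc0 : c ≠ 0) (hd0 : d ≠ 0) : c * d ≠ 0 := by
  obtain ⟨e, -, he, -⟩ := h𝒜.exists_centroid_inv hc hc0
  intro h
  apply hd0
  rw [← one_mul d, ← he, mul_assoc, h, mul_zero]

theorem centroid_one_ne_zero : (1 : centroid F A) ≠ 0 := by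
  obtain ⟨g, x, -, hx0⟩ := h𝒜.exists_homogeneous
  exact fun h => hx0 (LinearMap.congr_fun (congrArg Subtype.val h) x)

/-- On a product uv both compositions give c(u)d(v), and products span because A² = A. -/
theorem centroid_commute (c d : centroid F A) : c * d = d * c := by
  refine Subtype.ext (𝒜.hom_ext fun g x hx => ?_)
  have hx' := h𝒜.comp_le_prodSpan g hx
  rw [Grading.prodSpan] at hx'
  have hle : Submodule.span F {z | ∃ a b, a * b = g ∧ ∃ x ∈ 𝒜.comp a, ∃ y ∈ 𝒜.comp b, z = x * y} ≤
      LinearMap.eqLocus (c * d).1 (d * c).1 := by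
    refine Submodule.span_le.2 ?_
    rintro _ ⟨a, b, -, u, -, v, -, rfl⟩
    change c.1 (d.1 (u * v)) = d.1 (c.1 (u * v))
    rw [centroid.map_mul_right d, centroid.map_mul_left c, centroid.map_mul_left c,
      centroid.map_mul_right d]
  exact hle hx'

/-- Evaluation at a nonzero homogeneous x of degree k is injective on centroid elements and shifts
degrees by k, so independence is inherited from A. -/
theorem centroidComp_indep : iSupIndep (centroidComp 𝒜) := by
  obtain ⟨k, x, hx, hx0⟩ := h𝒜.exists_homogeneous
  refine iSupIndep_of_proj _ (fun g => 𝒜.proj (g * k) ∘ₗ LinearMap.applyₗ x ∘ₗ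
    (centroid F A).val.toLinearMap) (fun g c hc h => ?_) (fun g h hne c hc => ?_)
  · refine h𝒜.centroid_eq_zero hx hx0 ?_
    change 𝒜.proj (g * k) (c.1 x) = 0 at h
    rwa [𝒜.proj_of_mem (hc _ _ hx)] at h
  · exact 𝒜.proj_of_mem_ne (fun e => hne (mul_right_cancel e)) (hc _ _ hx)

/-- The centroid of a graded-simple algebra is the sum of its homogeneous components. -/
theorem iSup_centroidComp : ⨆ g, centroidComp 𝒜 g = ⊤ := by
  rw [eq_top_iff]
  rintro c -
  -- The degree-h part of c: on the component of degree g, follow c by the projection to degree hg.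
  let c' : G → A →ₗ[F] A := fun h => 𝒜.lift fun g => 𝒜.proj (h * g) ∘ₗ c.1
  have hc' : ∀ h g, ∀ x ∈ 𝒜.comp g, c' h x = 𝒜.proj (h * g) (c.1 x) := fun h g x hx =>
    𝒜.lift_apply _ hx
  have hmem : ∀ h, c' h ∈ centroid F A := fun h => by
    refine mem_centroid_of_homogeneous 𝒜 _ fun g k x hx y hy => ?_
    rw [hc' h _ _ (𝒜.mul_mem _ _ _ hx _ hy), hc' h _ _ hx, hc' h _ _ hy]
    constructor
    · rw [centroid.map_mul_left, ← mul_assoc, 𝒜.proj_mul_right _ _ hy]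
    · rw [centroid.map_mul_right, mul_left_comm, 𝒜.proj_mul_left _ _ hx]
  let d : G → centroid F A := fun h => ⟨c' h, hmem h⟩
  have hd : ∀ h, d h ∈ centroidComp 𝒜 h := fun h g x hx => by
    change c' h x ∈ _
    rw [hc' h g x hx]
    exact 𝒜.proj_mem _ _
  obtain ⟨k, x₀, hx, hx0⟩ := h𝒜.exists_homogeneous
  have hfin := 𝒜.finite_proj (c.1 x₀)
  classical
  let S : Finset G := hfin.toFinset.image fun g => g * k⁻¹
  -- Finiteness is tested on a single element: c(x₀) has finitely many components, and a centroid
  -- element that kills x₀ is zero.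
  have hS : ∀ h, h ∉ S → d h = 0 := fun h hh => by
    refine h𝒜.centroid_eq_zero hx hx0 ?_
    change c' h x₀ = 0
    rw [hc' h k x₀ hx]
    by_contra hne
    exact hh (Finset.mem_image.2 ⟨h * k, hfin.mem_toFinset.2 hne, by simp⟩)
  have hsum : c = ∑ h ∈ S, d h := by
    refine Subtype.ext (𝒜.hom_ext fun g x hx => 𝒜.ext_proj fun l => ?_)
    have e1 : (∑ h ∈ S, d h : centroid F A).1 x = ∑ h ∈ S, (d h).1 x := by
      rw [← Subalgebra.coe_val, map_sum, LinearMap.sum_apply]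
    rw [e1, map_sum]
    have e2 : 𝒜.proj l (c.1 x) = (d (l * g⁻¹)).1 x := by
      change _ = c' _ x
      rw [hc' _ g x hx, inv_mul_cancel_right]
    rw [e2, Finset.sum_eq_single (l * g⁻¹)]
    · rw [𝒜.proj_of_mem]
      simpa using hd (l * g⁻¹) g x hx
    · intro h _ hne
      refine 𝒜.proj_of_mem_ne ?_ (hd h g x hx)
      rintro rfl
      exact hne (by simp)
    · intro h
      rw [hS _ h]
      exact map_zero _
  rw [hsum]
  exact Submodule.sum_mem _ fun h _ => Submodule.mem_iSup_of_mem h (hd h)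

/-- The grading of the centroid of a graded-simple algebra. -/
def centroidGrading : Grading F G (centroid F A) where
  comp := centroidComp 𝒜
  indep := h𝒜.centroidComp_indep
  iSup_comp := h𝒜.iSup_centroidComp
  mul_mem _ _ _ hc _ hd := mul_mem_centroidComp hc hd

/-- A graded-simple algebra with trivial centroid is simple. -/
theorem isSimpleAlg (hC : centroid F A = ⊥) : IsSimpleAlg F A := by
  classical
  refine ⟨h𝒜.exists_mul_ne_zero, fun J hJ => ?_⟩
  by_cases hJ0 : J = ⊥
  · exact Or.inl hJ0
  right
  suffices h : ∃ g, ∃ x ∈ J, x ∈ 𝒜.comp g ∧ x ≠ 0 by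
    obtain ⟨g₀, x, hxJ, hx, hx0⟩ := h
    rw [eq_top_iff, ← 𝒜.iSup_comp]
    exact iSup_le fun g => (h𝒜.le_of_isIdealFamily (hJ.isIdealFamily 𝒜) (g₀ := g₀) ⟨hxJ, hx⟩
      hx0 g).trans inf_le_left
  -- `JS S` is the part of J supported in S. The set S chosen below has least cardinality among
  -- those for which this part is nonzero.
  let JS : Finset G → Submodule F A := fun S => J ⊓ ⨅ (g : G) (_ : g ∉ S), LinearMap.ker (𝒜.proj g)
  have mem_JS : ∀ S x, x ∈ JS S ↔ x ∈ J ∧ ∀ g, g ∉ S → 𝒜.proj g x = 0 := fun S x => by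
    simp [JS, Submodule.mem_iInf]
  obtain ⟨x₁, hx₁, hx₁0⟩ := Submodule.exists_mem_ne_zero_of_ne_bot hJ0
  have hex : ∃ n, ∃ S : Finset G, S.card = n ∧ ∃ x ∈ JS S, x ≠ 0 :=
    ⟨_, (𝒜.finite_proj x₁).toFinset, rfl, x₁, (mem_JS _ _).2 ⟨hx₁, fun g hg => by
      simpa using hg⟩, hx₁0⟩
  obtain ⟨S, hScard, x, hxS, hx0⟩ := Nat.find_spec hex
  have hmin : ∀ T : Finset G, T.card < S.card → ∀ z ∈ JS T, z = 0 := fun T hT z hz => by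
    by_contra hz0
    exact Nat.find_min hex (hScard ▸ hT) ⟨T, rfl, z, hz, hz0⟩
  obtain ⟨s, hs⟩ := 𝒜.exists_homogeneous_ne_zero hx0
  have hsS : s ∈ S := by
    by_contra h
    exact hs (((mem_JS S x).1 hxS).2 s h)
  -- The translate of S that carries s to g. Multiplication by an element of degree k maps `JS (T
  -- g)` into `JS (T (k * g))`.
  let T : G → Finset G := fun g => S.image fun t => g * s⁻¹ * t
  have hgT : ∀ g, g ∈ T g := fun g => Finset.mem_image.2 ⟨s, hsS, by simp⟩
  have hcT : ∀ g, (T g).card ≤ S.card := fun g => Finset.card_image_le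
  -- An element with vanishing g-component would be supported in fewer than |S| degrees, so
  -- minimality makes it zero. Elements of `JS (T g)` are thus determined by their g-component.
  have hinj : ∀ g, ∀ z ∈ JS (T g), 𝒜.proj g z = 0 → z = 0 := fun g z hz h0 => by
    refine hmin ((T g).erase g) ((Finset.card_erase_lt_of_mem (hgT g)).trans_le (hcT g)) z ?_
    refine (mem_JS _ _).2 ⟨((mem_JS _ _).1 hz).1, fun k hk => ?_⟩
    by_cases hkg : k = g
    · rwa [hkg]
    · exact ((mem_JS _ _).1 hz).2 k fun h => hk (Finset.mem_erase.2 ⟨hkg, h⟩)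
  have hJl : ∀ g k, ∀ z ∈ JS (T g), ∀ a ∈ 𝒜.comp k, a * z ∈ JS (T (k * g)) := by
    intro g k z hz a ha
    obtain ⟨hzJ, hz⟩ := (mem_JS _ _).1 hz
    refine (mem_JS _ _).2 ⟨(hJ z hzJ a).1, fun l hl => ?_⟩
    have := 𝒜.proj_mul_left (k⁻¹ * l) z ha
    rw [mul_inv_cancel_left] at this
    rw [this, hz, mul_zero]
    intro h
    refine hl ?_
    obtain ⟨t, ht, e⟩ := Finset.mem_image.1 h
    refine Finset.mem_image.2 ⟨t, ht, ?_⟩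
    rw [mul_assoc k, mul_assoc k, e, mul_inv_cancel_left]
  have hJr : ∀ g k, ∀ z ∈ JS (T g), ∀ a ∈ 𝒜.comp k, z * a ∈ JS (T (g * k)) := by
    intro g k z hz a ha
    obtain ⟨hzJ, hz⟩ := (mem_JS _ _).1 hz
    refine (mem_JS _ _).2 ⟨(hJ z hzJ a).2, fun l hl => ?_⟩
    have := 𝒜.proj_mul_right (l * k⁻¹) z ha
    rw [inv_mul_cancel_right] at this
    rw [this, hz, zero_mul]
    intro h
    refine hl ?_
    obtain ⟨t, ht, e⟩ := Finset.mem_image.1 h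
    refine Finset.mem_image.2 ⟨t, ht, ?_⟩
    rw [mul_comm g k, mul_assoc k, mul_assoc k, e, mul_comm k, inv_mul_cancel_right]
  have hK : 𝒜.IsIdealFamily fun g => (JS (T g)).map (𝒜.proj g) := by
    refine ⟨fun g => ?_, ?_, ?_⟩
    · rintro _ ⟨z, -, rfl⟩
      exact 𝒜.proj_mem g z
    · rintro g k _ ⟨z, hz, rfl⟩ a ha
      exact ⟨a * z, hJl g k z hz a ha, 𝒜.proj_mul_left g z ha⟩
    · rintro g k _ ⟨z, hz, rfl⟩ a ha
      exact ⟨z * a, hJr g k z hz a ha, 𝒜.proj_mul_right g z ha⟩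
  have hxT : x ∈ JS (T s) := by
    have : T s = S := by simp only [T, mul_inv_cancel, one_mul, Finset.image_id']
    rwa [this]
  have hfull := h𝒜.le_of_isIdealFamily hK (g₀ := s) ⟨x, hxT, rfl⟩ hs
  choose r hr using fun g => exists_leftInverse_on (𝒜.proj g) (JS (T g)) (hinj g)
  -- By graded simplicity the g-components of elements of `JS (T g)` fill the whole component.
  -- Recovering z from its g-component is therefore defined on all of A, and it commutes with
  -- multiplications because these translate the sets `T g`.
  let Z : A →ₗ[F] A := 𝒜.lift r
  have hZ : ∀ g, ∀ z ∈ JS (T g), Z (𝒜.proj g z) = z := fun g z hz => by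
    rw [← hr g z hz, hr g z hz]
    exact (𝒜.lift_apply r (𝒜.proj_mem g z)).trans (hr g z hz)
  have hZc : Z ∈ centroid F A := by
    refine mem_centroid_of_homogeneous 𝒜 Z fun g k y hy w hw => ?_
    obtain ⟨z, hz, rfl⟩ := hfull g hy
    obtain ⟨v, hv, hvw⟩ := hfull k hw
    constructor
    · rw [hZ _ _ hz, ← 𝒜.proj_mul_right _ _ hw, hZ _ _ (hJr _ _ _ hz _ hw)]
    · rw [← hvw, hZ _ _ hv, ← 𝒜.proj_mul_left _ _ (𝒜.proj_mem g z),
        hZ _ _ (hJl _ _ _ hv _ (𝒜.proj_mem g z))]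
  rw [hC] at hZc
  -- As Z is a scalar, x is a multiple of its s-component, hence a nonzero homogeneous element of J.
  obtain ⟨r, hr⟩ := Algebra.mem_bot.1 hZc
  have hxs : x = r • 𝒜.proj s x := by
    have := hZ s x hxT
    rw [← hr] at this
    exact this.symm
  exact ⟨s, x, ((mem_JS _ _).1 hxT).1, hxs ▸ Submodule.smul_mem _ _ (𝒜.proj_mem s x), hx0⟩

end IsGradedSimple

end Centroid

/-! ### Graded isomorphisms -/

section GradedIso

variable {F G A B : Type*} [Field F] [CommGroup G] [NonUnitalNonAssocRing A] [Module F A]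
  [NonUnitalNonAssocRing B] [Module F B]

theorem GradedIso.symm {F G A B : Type*} [Field F] [NonUnitalNonAssocRing A] [Module F A]
    [NonUnitalNonAssocRing B] [Module F B] {𝒜 : G → Submodule F A} {ℬ : G → Submodule F B}
    (h : GradedIso 𝒜 ℬ) : GradedIso ℬ 𝒜 := by
  obtain ⟨φ, hmul, hcomp⟩ := h
  refine ⟨φ.symm, fun x y => ?_, fun g => ?_⟩
  · rw [LinearEquiv.symm_apply_eq, hmul]
    simp
  · rw [← hcomp g]
    ext x
    simp

/-- A linear map that is multiplicative on homogeneous elements and bijective on each component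
is a graded isomorphism. -/
theorem gradedIso_of_linearMap (𝒜 : Grading F G A) (ℬ : Grading F G B) (φ : A →ₗ[F] B)
    (mem : ∀ g, ∀ x ∈ 𝒜.comp g, φ x ∈ ℬ.comp g)
    (inj : ∀ g, ∀ x ∈ 𝒜.comp g, φ x = 0 → x = 0)
    (surj : ∀ g, ∀ y ∈ ℬ.comp g, ∃ x ∈ 𝒜.comp g, φ x = y)
    (mul : ∀ g k, ∀ x ∈ 𝒜.comp g, ∀ y ∈ 𝒜.comp k, φ (x * y) = φ x * φ y) :
    GradedIso 𝒜.comp ℬ.comp := by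
  have hproj : ∀ g x, φ (𝒜.proj g x) = ℬ.proj g (φ x) := fun g x => by
    induction x using 𝒜.induction with
    | zero => simp
    | add x y hx hy => simp [hx, hy]
    | hom k x hx =>
      by_cases h : k = g
      · subst h
        rw [𝒜.proj_of_mem hx, ℬ.proj_of_mem (mem _ _ hx)]
      · rw [𝒜.proj_of_mem_ne h hx, ℬ.proj_of_mem_ne h (mem _ _ hx), map_zero]
  have hinj : Function.Injective φ := by
    rw [injective_iff_map_eq_zero]
    intro x hx
    refine 𝒜.ext_proj fun g => ?_
    rw [map_zero]
    exact inj g _ (𝒜.proj_mem g x) (by rw [hproj, hx, map_zero])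
  have hsurj : Function.Surjective φ := by
    rw [← LinearMap.range_eq_top, eq_top_iff, ← ℬ.iSup_comp]
    refine iSup_le fun g y hy => ?_
    obtain ⟨x, -, rfl⟩ := surj g y hy
    exact ⟨x, rfl⟩
  refine ⟨LinearEquiv.ofBijective φ ⟨hinj, hsurj⟩, fun x y => ?_, fun g => ?_⟩
  · change φ (x * y) = φ x * φ y
    induction x using 𝒜.induction with
    | zero => simp
    | add x x' hx hx' => simp [add_mul, hx, hx']
    | hom g x hx =>
      induction y using 𝒜.induction with
      | zero => simp
      | add y y' hy hy' => simp [mul_add, hy, hy']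
      | hom k y hy => exact mul g k x hx y hy
  · ext y
    constructor
    · rintro ⟨x, hx, rfl⟩
      exact mem g x hx
    · intro hy
      obtain ⟨x, hx, rfl⟩ := surj g y hy
      exact ⟨x, hx, rfl⟩

end GradedIso

/-! ### Loop maps -/

section LoopMap

variable {F G A B : Type*} [Field F] [CommGroup G] [NonUnitalNonAssocRing A] [Module F A]
  [NonUnitalNonAssocRing B] [Module F B] {H : Subgroup G}

/-- A linear map `P : B → A` that exhibits the `G`-graded algebra `B` as the twisted loop algebra
`L_π^τ(A)` of the `G ⧸ H`-graded algebra `A`, corresponding to `a ⊗ g ↦ a`. -/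
structure IsLoopMap (ℬ : Grading F G B) (𝒜 : Grading F (G ⧸ H) A) (τ : Z2Sym G Fˣ)
    (P : B →ₗ[F] A) : Prop where
  mem : ∀ g, ∀ x ∈ ℬ.comp g, P x ∈ 𝒜.comp (QuotientGroup.mk' H g)
  inj : ∀ g, ∀ x ∈ ℬ.comp g, P x = 0 → x = 0
  surj : ∀ g, ∀ a ∈ 𝒜.comp (QuotientGroup.mk' H g), ∃ x ∈ ℬ.comp g, P x = a
  mul : ∀ g k, ∀ x ∈ ℬ.comp g, ∀ y ∈ ℬ.comp k, P (x * y) = (τ.1 (g, k) : F) • (P x * P y)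

section Standard

/-- The linear map `a ⊗ g ↦ a` on `A ⊗ F G`. -/
noncomputable def evalOne (F G A : Type*) [Field F] [CommGroup G] [NonUnitalNonAssocRing A]
    [Module F A] : A ⊗[F] MonoidAlgebra F G →ₗ[F] A :=
  (TensorProduct.rid F A).toLinearMap ∘ₗ LinearMap.lTensor A
    (Finsupp.linearCombination F (fun _ : G => (1 : F)) ∘ₗ
      (MonoidAlgebra.coeffLinearEquiv F).toLinearMap)

theorem evalOne_tmul (a : A) (g : G) :
    evalOne F G A (a ⊗ₜ[F] MonoidAlgebra.single g (1 : F)) = a := by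
  simp [evalOne]

variable [IsScalarTower F A A] [SMulCommClass F A A]

/-- The canonical map `L_π^τ(A) → A`. -/
noncomputable def loopMap (𝒜 : Grading F (G ⧸ H) A) (τ : Z2Sym G Fˣ) :
    Twist (loopGrading 𝒜) τ →ₗ[F] A :=
  (evalOne F G A ∘ₗ (loopAlgebra 𝒜).toSubmodule.subtype : loopAlgebra 𝒜 →ₗ[F] A)

theorem isLoopMap_loopMap (𝒜 : Grading F (G ⧸ H) A) (τ : Z2Sym G Fˣ) :
    IsLoopMap (twistedLoopGrading 𝒜 τ) 𝒜 τ (loopMap 𝒜 τ) := by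
  have key : ∀ g, ∀ x ∈ (twistedLoopGrading 𝒜 τ).comp g,
      ∃ a ∈ 𝒜.comp (QuotientGroup.mk' H g), loopMap 𝒜 τ x = a ∧
        Subtype.val (p := (· ∈ loopAlgebra 𝒜)) x = a ⊗ₜ[F] MonoidAlgebra.single g (1 : F) := by
    rintro g ⟨x, h⟩ ⟨a, ha, rfl⟩
    exact ⟨a, ha, evalOne_tmul a g, rfl⟩
  refine ⟨fun g x hx => ?_, fun g x hx h => ?_, fun g a ha => ?_, fun g k x hx y hy => ?_⟩
  · obtain ⟨a, ha, h, -⟩ := key g x hx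
    exact h ▸ ha
  · obtain ⟨a, ha, h', h''⟩ := key g x hx
    rw [← h', h, TensorProduct.zero_tmul] at h''
    exact Subtype.ext h''
  · exact ⟨(⟨a ⊗ₜ[F] MonoidAlgebra.single g (1 : F),
      (le_iSup (loopComp 𝒜) g) ⟨a, ha, rfl⟩⟩ : loopAlgebra 𝒜), ⟨a, ha, rfl⟩, evalOne_tmul a g⟩
  · obtain ⟨a, ha, h1, h1'⟩ := key g x hx
    obtain ⟨b, hb, h2, h2'⟩ := key k y hy
    rw [h1, h2]
    refine (congrArg (loopMap 𝒜 τ) ((loopGrading 𝒜).twistMul_apply τ hx hy)).trans ?_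
    change evalOne F G A ((τ.1 (g, k) : F) • (Subtype.val (p := (· ∈ loopAlgebra 𝒜)) x *
      Subtype.val (p := (· ∈ loopAlgebra 𝒜)) y)) = _
    rw [h1', h2', map_smul, Algebra.TensorProduct.tmul_mul_tmul, MonoidAlgebra.single_mul_single,
      one_mul, evalOne_tmul]

end Standard

namespace IsLoopMap

variable {ℬ : Grading F G B} {𝒜 : Grading F (G ⧸ H) A} {τ : Z2Sym G Fˣ} {P : B →ₗ[F] A}

/-- A loop map has linear sections, one for each degree. -/
theorem exists_section (hP : IsLoopMap ℬ 𝒜 τ P) : ∃ ρ : G → A →ₗ[F] B,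
    (∀ g, ∀ x ∈ ℬ.comp g, ρ g (P x) = x) ∧
    (∀ g, ∀ a ∈ 𝒜.comp (QuotientGroup.mk' H g), ρ g a ∈ ℬ.comp g) ∧
    ∀ g, ∀ a ∈ 𝒜.comp (QuotientGroup.mk' H g), P (ρ g a) = a := by
  choose ρ hρ using fun g => exists_leftInverse_on P (ℬ.comp g) (hP.inj g)
  refine ⟨ρ, hρ, fun g a ha => ?_, fun g a ha => ?_⟩
  · obtain ⟨x, hx, rfl⟩ := hP.surj g a ha
    rwa [hρ g x hx]
  · obtain ⟨x, hx, rfl⟩ := hP.surj g a ha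
    rw [hρ g x hx]

theorem injOn (hP : IsLoopMap ℬ 𝒜 τ P) {g : G} {x y : B} (hx : x ∈ ℬ.comp g)
    (hy : y ∈ ℬ.comp g) (h : P x = P y) : x = y :=
  sub_eq_zero.1 (hP.inj g _ (Submodule.sub_mem _ hx hy) (by rw [map_sub, h, sub_self]))

/-- Two algebras that are twisted loop algebras of `A` for the same cocycle are isomorphic. -/
theorem gradedIso {B' : Type*} [NonUnitalNonAssocRing B'] [Module F B']
    {ℬ' : Grading F G B'} {P' : B' →ₗ[F] A}
    (hP : IsLoopMap ℬ 𝒜 τ P) (hP' : IsLoopMap ℬ' 𝒜 τ P') : GradedIso ℬ.comp ℬ'.comp := by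
  -- The isomorphism is P in degree g followed by the inverse of P' on that degree.
  obtain ⟨ρ, hρ1, hρ2, hρ3⟩ := hP'.exists_section
  have hφ : ∀ g, ∀ x ∈ ℬ.comp g, ℬ.lift (fun g => ρ g ∘ₗ P) x = ρ g (P x) := fun g x hx =>
    ℬ.lift_apply _ hx
  refine gradedIso_of_linearMap ℬ ℬ' (ℬ.lift fun g => ρ g ∘ₗ P) ?_ ?_ ?_ ?_
  · intro g x hx
    rw [hφ g x hx]
    exact hρ2 g _ (hP.mem g x hx)
  · intro g x hx h
    rw [hφ g x hx] at h
    refine hP.inj g x hx ?_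
    rw [← hρ3 g _ (hP.mem g x hx), h, map_zero]
  · intro g y hy
    obtain ⟨x, hx, h⟩ := hP.surj g _ (hP'.mem g y hy)
    exact ⟨x, hx, by rw [hφ g x hx, h, hρ1 g y hy]⟩
  · intro g k x hx y hy
    have hxy := ℬ.mul_mem _ _ _ hx _ hy
    have h1 := hρ2 g _ (hP.mem g x hx)
    have h2 := hρ2 k _ (hP.mem k y hy)
    rw [hφ _ _ hxy, hφ g x hx, hφ k y hy]
    refine hP'.injOn (hρ2 _ _ (hP.mem _ _ hxy)) (ℬ'.mul_mem _ _ _ h1 _ h2) ?_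
    rw [hρ3 _ _ (hP.mem _ _ hxy), hP'.mul g k _ h1 _ h2, hρ3 g _ (hP.mem g x hx),
      hρ3 k _ (hP.mem k y hy), hP.mul g k x hx y hy]

/-- Loop maps can be composed with graded isomorphisms. -/
theorem comp_gradedIso {B' : Type*} [NonUnitalNonAssocRing B'] [Module F B']
    {ℬ' : Grading F G B'} (hP : IsLoopMap ℬ 𝒜 τ P) (h : GradedIso ℬ'.comp ℬ.comp) :
    ∃ P' : B' →ₗ[F] A, IsLoopMap ℬ' 𝒜 τ P' := by
  obtain ⟨φ, hmul, hcomp⟩ := h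
  have hmem : ∀ g, ∀ x ∈ ℬ'.comp g, φ x ∈ ℬ.comp g := fun g x hx =>
    hcomp g ▸ ⟨x, hx, rfl⟩
  refine ⟨P ∘ₗ φ.toLinearMap, fun g x hx => hP.mem g _ (hmem g x hx), fun g x hx h => ?_,
    fun g a ha => ?_, fun g k x hx y hy => ?_⟩
  · exact φ.map_eq_zero_iff.1 (hP.inj g _ (hmem g x hx) h)
  · obtain ⟨y, hy, rfl⟩ := hP.surj g a ha
    rw [← hcomp g] at hy
    obtain ⟨x, hx, rfl⟩ := hy
    exact ⟨x, hx, rfl⟩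
  · change P (φ (x * y)) = _
    rw [hmul]
    exact hP.mul g k _ (hmem g x hx) _ (hmem k y hy)

end IsLoopMap

end LoopMap

/-! ### Simplicity and centroid of twisted loop algebras -/

namespace IsLoopMap

variable {F G A B : Type*} [Field F] [CommGroup G] [NonUnitalNonAssocRing A] [Module F A]
  [NonUnitalNonAssocRing B] [Module F B] {H : Subgroup G}
  {ℬ : Grading F G B} {𝒜 : Grading F (G ⧸ H) A} {τ : Z2Sym G Fˣ} {P : B →ₗ[F] A}

theorem smul_inv_mul (hP : IsLoopMap ℬ 𝒜 τ P) {g k : G} {x y : B} (hx : x ∈ ℬ.comp g)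
    (hy : y ∈ ℬ.comp k) : P x * P y = (τ.1 (g, k) : F)⁻¹ • P (x * y) := by
  rw [hP.mul g k x hx y hy, inv_smul_smul₀ (Units.ne_zero _)]

/-- If a twisted loop algebra of `A` is graded-simple, then `A` is graded-simple. -/
theorem isGradedSimple_base (hP : IsLoopMap ℬ 𝒜 τ P) (hℬ : IsGradedSimple ℬ) :
    IsGradedSimple 𝒜 := by
  have hπ := QuotientGroup.mk'_surjective H
  refine isGradedSimple_of_isIdealFamily 𝒜 ?_ ?_
  · obtain ⟨u, v, huv⟩ := hℬ.exists_mul_ne_zero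
    obtain ⟨a, b, u, hu, v, hv, huv⟩ := ℬ.exists_homogeneous_mul_ne_zero huv
    refine ⟨P u, P v, fun h => huv (hP.inj _ _ (ℬ.mul_mem _ _ _ hu _ hv) ?_)⟩
    rw [hP.mul a b u hu v hv, h, smul_zero]
  intro K hK a₀ y₀ hy₀ hy₀0 a y hy
  have hK' : ℬ.IsIdealFamily fun g => ℬ.comp g ⊓ (K (QuotientGroup.mk' H g)).comap P := by
    refine ⟨fun g => inf_le_left, fun g k x hx z hz => ⟨ℬ.mul_mem _ _ _ hz _ hx.1, ?_⟩,
      fun g k x hx z hz => ⟨ℬ.mul_mem _ _ _ hx.1 _ hz, ?_⟩⟩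
    · refine Submodule.mem_comap.2 ?_
      rw [hP.mul _ _ _ hz _ hx.1, map_mul]
      exact Submodule.smul_mem _ _ (hK.mul_left _ _ _ hx.2 _ (hP.mem _ _ hz))
    · refine Submodule.mem_comap.2 ?_
      rw [hP.mul _ _ _ hx.1 _ hz, map_mul]
      exact Submodule.smul_mem _ _ (hK.mul_right _ _ _ hx.2 _ (hP.mem _ _ hz))
  obtain ⟨g₀, rfl⟩ := hπ a₀
  obtain ⟨g, rfl⟩ := hπ a
  obtain ⟨x₀, hx₀, rfl⟩ := hP.surj g₀ y₀ (hK.le _ hy₀)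
  obtain ⟨x, hx, rfl⟩ := hP.surj g y hy
  exact (hℬ.le_of_isIdealFamily hK' (g₀ := g₀) ⟨hx₀, hy₀⟩
    (fun h => hy₀0 (by rw [h, map_zero])) g hx).2

theorem centroid_ext [IsScalarTower F B B] [SMulCommClass F B B] (hP : IsLoopMap ℬ 𝒜 τ P)
    {k : G} {c d : centroid F B} (hc : c ∈ centroidComp ℬ k) (hd : d ∈ centroidComp ℬ k)
    (h : ∀ g, ∀ x ∈ ℬ.comp g, P (c.1 x) = P (d.1 x)) : c = d :=
  Subtype.ext (ℬ.hom_ext fun g x hx => hP.injOn (hc g x hx) (hd g x hx) (h g x hx))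

variable [IsScalarTower F A A] [SMulCommClass F A A]

/-- The twisted loop algebra of a simple algebra is graded-simple. -/
theorem isGradedSimple_of_isSimpleAlg (hP : IsLoopMap ℬ 𝒜 τ P) (hA : IsSimpleAlg F A) :
    IsGradedSimple ℬ := by
  have h𝒜 := hA.isGradedSimple 𝒜
  have hπ := QuotientGroup.mk'_surjective H
  refine isGradedSimple_of_isIdealFamily ℬ ?_ ?_
  · obtain ⟨u, v, huv⟩ := h𝒜.exists_mul_ne_zero
    obtain ⟨a, b, u, hu, v, hv, huv⟩ := 𝒜.exists_homogeneous_mul_ne_zero huv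
    obtain ⟨g, rfl⟩ := hπ a
    obtain ⟨k, rfl⟩ := hπ b
    obtain ⟨x, hx, rfl⟩ := hP.surj g u hu
    obtain ⟨y, hy, rfl⟩ := hP.surj k v hv
    refine ⟨x, y, fun h => huv ?_⟩
    rw [hP.smul_inv_mul hx hy, h, map_zero, smul_zero]
  intro K hK g₀ x₀ hx₀ hx₀0
  -- The images P(K g) may depend on g and not only on its class, so they are intersected over each
  -- coset to obtain a family on G/H.
  let J : G ⧸ H → Submodule F A := fun a =>
    𝒜.comp a ⊓ ⨅ (g : G) (_ : QuotientGroup.mk' H g = a), (K g).map P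
  have mem_J : ∀ a y, y ∈ J a ↔
      y ∈ 𝒜.comp a ∧ ∀ g, QuotientGroup.mk' H g = a → y ∈ (K g).map P := fun a y => by
    simp only [J, Submodule.mem_inf, Submodule.mem_iInf]
  -- For every l over the degree of the product, z lifts to degree l g⁻¹, so the product lies in P(K
  -- l) for all such l at once.
  have hl : ∀ g, ∀ x ∈ K g, ∀ b, ∀ z ∈ 𝒜.comp b, z * P x ∈ J (b * QuotientGroup.mk' H g) := by
    intro g x hx b z hz
    refine (mem_J _ _).2 ⟨𝒜.mul_mem _ _ _ hz _ (hP.mem g x (hK.le g hx)), fun l hl => ?_⟩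
    have hb : QuotientGroup.mk' H (l * g⁻¹) = b := by rw [map_mul, hl, map_inv, mul_inv_cancel_right]
    obtain ⟨w, hw, rfl⟩ := hP.surj (l * g⁻¹) z (hb ▸ hz)
    rw [hP.smul_inv_mul hw (hK.le g hx)]
    refine Submodule.smul_mem _ _ ⟨_, ?_, rfl⟩
    simpa using hK.mul_left _ _ x hx w hw
  have hr : ∀ g, ∀ x ∈ K g, ∀ b, ∀ z ∈ 𝒜.comp b, P x * z ∈ J (QuotientGroup.mk' H g * b) := by
    intro g x hx b z hz
    refine (mem_J _ _).2 ⟨𝒜.mul_mem _ _ _ (hP.mem g x (hK.le g hx)) _ hz, fun l hl => ?_⟩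
    have hb : QuotientGroup.mk' H (g⁻¹ * l) = b := by rw [map_mul, hl, map_inv, inv_mul_cancel_left]
    obtain ⟨w, hw, rfl⟩ := hP.surj (g⁻¹ * l) z (hb ▸ hz)
    rw [hP.smul_inv_mul (hK.le g hx) hw]
    refine Submodule.smul_mem _ _ ⟨_, ?_, rfl⟩
    simpa using hK.mul_right _ _ x hx w hw
  have hJ : 𝒜.IsIdealFamily J := by
    refine ⟨fun _ => inf_le_left, fun a b y hy z hz => ?_, fun a b y hy z hz => ?_⟩
    all_goals
      obtain ⟨g, rfl⟩ := hπ a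
      obtain ⟨x, hx, rfl⟩ := ((mem_J _ _).1 hy).2 g rfl
    · exact hl g x hx b z hz
    · exact hr g x hx b z hz
  by_cases h0 : ∃ a, ∃ y ∈ J a, y ≠ 0
  · obtain ⟨a, y, hy, hy0⟩ := h0
    intro g x hx
    have := h𝒜.le_of_isIdealFamily hJ hy hy0 _ (hP.mem g x hx)
    obtain ⟨x', hx', e⟩ := ((mem_J _ _).1 this).2 g rfl
    exact hP.injOn (hK.le g hx') hx e ▸ hx'
  -- If J vanishes, then P x₀ annihilates A on both sides. The two-sided annihilator N is an ideal;
  -- N = 0 contradicts P x₀ ≠ 0, and N = A contradicts the nonzero multiplication.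
  · exfalso
    push Not at h0
    have hzl : ∀ z, z * P x₀ = 0 := fun z => by
      induction z using 𝒜.induction with
      | zero => simp
      | add z z' hz hz' => rw [add_mul, hz, hz', add_zero]
      | hom b z hz => exact h0 _ _ (hl g₀ x₀ hx₀ b z hz)
    have hzr : ∀ z, P x₀ * z = 0 := fun z => by
      induction z using 𝒜.induction with
      | zero => simp
      | add z z' hz hz' => rw [mul_add, hz, hz', add_zero]
      | hom b z hz => exact h0 _ _ (hr g₀ x₀ hx₀ b z hz)
    let N : Submodule F A :=
      { carrier := {y | ∀ z, z * y = 0 ∧ y * z = 0}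
        zero_mem' := by simp
        add_mem' := fun hy hy' z => by
          rw [mul_add, add_mul, (hy z).1, (hy z).2, (hy' z).1, (hy' z).2]
          simp
        smul_mem' := fun r y hy z => by
          rw [mul_smul_comm, smul_mul_assoc, (hy z).1, (hy z).2]
          simp }
    have hN : IsAlgIdeal N := fun y hy z => by
      rw [(hy z).1, (hy z).2]
      exact ⟨N.zero_mem, N.zero_mem⟩
    rcases hA.2 N hN with h | h
    · have : P x₀ ∈ N := fun z => ⟨hzl z, hzr z⟩
      rw [h] at this
      exact hx₀0 (hP.inj _ _ (hK.le _ hx₀) ((Submodule.mem_bot F).1 this))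
    · obtain ⟨u, v, huv⟩ := hA.1
      have : v ∈ N := h ▸ Submodule.mem_top
      exact huv (this u).1

variable [IsScalarTower F B B] [SMulCommClass F B B]

/-- Homogeneous elements of the centroid of `A` lift to a twisted loop algebra of `A`. -/
theorem exists_centroid_lift (hP : IsLoopMap ℬ 𝒜 τ P) (k : G) {d : centroid F A}
    (hd : d ∈ centroidComp 𝒜 (QuotientGroup.mk' H k)) :
    ∃ c ∈ centroidComp ℬ k, ∀ g, ∀ x ∈ ℬ.comp g, P (c.1 x) = (τ.1 (k, g) : F) • d.1 (P x) := by
  obtain ⟨ρ, -, hρ2, hρ3⟩ := hP.exists_section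
  -- The factor τ(k, g) compensates for the twist in P: the cocycle identity gives compatibility
  -- with left factors, and symmetry is needed in addition for right factors.
  let c : B →ₗ[F] B := ℬ.lift fun g => (τ.1 (k, g) : F) • (ρ (k * g) ∘ₗ d.1 ∘ₗ P)
  have hc : ∀ g, ∀ x ∈ ℬ.comp g, c x = (τ.1 (k, g) : F) • ρ (k * g) (d.1 (P x)) := fun g x hx =>
    ℬ.lift_apply _ hx
  have hdP : ∀ g, ∀ x ∈ ℬ.comp g, d.1 (P x) ∈ 𝒜.comp (QuotientGroup.mk' H (k * g)) :=
    fun g x hx => by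
      rw [map_mul]
      exact hd _ _ (hP.mem g x hx)
  have hmem : ∀ g, ∀ x ∈ ℬ.comp g, c x ∈ ℬ.comp (k * g) := fun g x hx => by
    rw [hc g x hx]
    exact Submodule.smul_mem _ _ (hρ2 _ _ (hdP g x hx))
  have hPc : ∀ g, ∀ x ∈ ℬ.comp g, P (c x) = (τ.1 (k, g) : F) • d.1 (P x) := fun g x hx => by
    rw [hc g x hx, map_smul, hρ3 _ _ (hdP g x hx)]
  have hcc : c ∈ centroid F B := by
    refine mem_centroid_of_homogeneous ℬ c fun g l x hx y hy => ?_
    have hxy := ℬ.mul_mem _ _ _ hx _ hy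
    have h1 := hmem _ _ hxy
    constructor
    · have h2 := ℬ.mul_mem _ _ _ (hmem g x hx) _ hy
      rw [mul_assoc] at h2
      refine hP.injOn h1 h2 ?_
      rw [hPc _ _ hxy, hP.mul _ _ _ hx _ hy, hP.mul _ _ _ (hmem g x hx) _ hy, hPc g x hx, map_smul,
        centroid.map_mul_left, smul_mul_assoc, smul_smul, smul_smul]
      congr 1
      have := congrArg Units.val (Z2Sym.cocycle τ k g l)
      simp only [Units.val_mul] at this
      rw [← this, mul_comm]
    · have h2 := ℬ.mul_mem _ _ _ hx _ (hmem l y hy)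
      rw [mul_left_comm] at h2
      refine hP.injOn h1 h2 ?_
      rw [hPc _ _ hxy, hP.mul _ _ _ hx _ hy, hP.mul _ _ _ hx _ (hmem l y hy), hPc l y hy, map_smul,
        centroid.map_mul_right, mul_smul_comm, smul_smul, smul_smul]
      congr 1
      have e1 := congrArg Units.val (Z2Sym.cocycle τ k g l)
      have e2 := congrArg Units.val (Z2Sym.cocycle τ g k l)
      rw [Z2Sym.symm τ g k, mul_comm g k] at e2
      simp only [Units.val_mul] at e1 e2
      rw [← e1, ← e2]
  exact ⟨⟨c, hcc⟩, hmem, hPc⟩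

/-- Homogeneous elements of the centroid of a twisted loop algebra of a graded-simple algebra `A`
come from the centroid of `A`. -/
theorem exists_centroid_descend (hP : IsLoopMap ℬ 𝒜 τ P) (h𝒜 : IsGradedSimple 𝒜) (k : G)
    {c : centroid F B} (hc : c ∈ centroidComp ℬ k) :
    ∃ d ∈ centroidComp 𝒜 (QuotientGroup.mk' H k),
      ∀ g, ∀ x ∈ ℬ.comp g, P (c.1 x) = (τ.1 (k, g) : F) • d.1 (P x) := by
  obtain ⟨ρ, hρ1, -, -⟩ := hP.exists_section
  obtain ⟨ξ, hξ, -⟩ := exists_section_one H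
  have hπ := QuotientGroup.mk'_surjective H
  -- The operator that c induces on the component of degree π(g), computed through lifts to degree
  -- g.
  let E : G → A →ₗ[F] A := fun g => (τ.1 (k, g) : F)⁻¹ • (P ∘ₗ c.1 ∘ₗ ρ g)
  have hE : ∀ g, ∀ x ∈ ℬ.comp g, E g (P x) = (τ.1 (k, g) : F)⁻¹ • P (c.1 x) := fun g x hx => by
    simp only [E, LinearMap.smul_apply, LinearMap.comp_apply, hρ1 g x hx]
  have hτ : ∀ g l, (τ.1 (g, l) : F)⁻¹ * (τ.1 (k, g * l) : F)⁻¹ * (τ.1 (k * g, l) : F) =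
      (τ.1 (k, g) : F)⁻¹ := fun g l => by
    have := congrArg Units.val (Z2Sym.cocycle τ k g l)
    simp only [Units.val_mul] at this
    field_simp
    linear_combination this
  have hEl : ∀ g l, ∀ x ∈ ℬ.comp g, ∀ y ∈ ℬ.comp l,
      E (g * l) (P x * P y) = E g (P x) * P y := fun g l x hx y hy => by
    rw [hP.smul_inv_mul hx hy, map_smul, hE _ _ (ℬ.mul_mem _ _ _ hx _ hy), centroid.map_mul_left,
      hP.mul _ _ _ (hc g x hx) _ hy, hE g x hx, smul_mul_assoc, smul_smul, smul_smul, hτ]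
  have hEr : ∀ g l, ∀ x ∈ ℬ.comp g, ∀ y ∈ ℬ.comp l,
      E (g * l) (P x * P y) = P x * E l (P y) := fun g l x hx y hy => by
    have e := hτ l g
    rw [hP.smul_inv_mul hx hy, map_smul, hE _ _ (ℬ.mul_mem _ _ _ hx _ hy), centroid.map_mul_right,
      hP.mul _ _ _ hx _ (hc l y hy), hE l y hy, mul_smul_comm, smul_smul, smul_smul, ← e,
      mul_comm g l, Z2Sym.symm τ g l, Z2Sym.symm τ g (k * l)]
  -- The operator depends only on π(g): components of A are spanned by products P(x)v, and on these
  -- E l equals E p (P x) times v, with the degree p of x fixed while l varies.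
  have hEind : ∀ g g', QuotientGroup.mk' H g = QuotientGroup.mk' H g' →
      ∀ y ∈ 𝒜.comp (QuotientGroup.mk' H g), E g y = E g' y := by
    intro g g' hgg' y hy
    suffices h : 𝒜.prodSpan (QuotientGroup.mk' H g) ≤ LinearMap.eqLocus (E g) (E g') from
      h (h𝒜.comp_le_prodSpan _ hy)
    refine Submodule.span_le.2 ?_
    rintro _ ⟨a, b, hab, u, hu, v, hv, rfl⟩
    obtain ⟨p, rfl⟩ := hπ a
    obtain ⟨x, hx, rfl⟩ := hP.surj p u hu
    have hb : ∀ l, QuotientGroup.mk' H l = QuotientGroup.mk' H g →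
        E l (P x * v) = E p (P x) * v := by
      intro l hl
      have : QuotientGroup.mk' H (p⁻¹ * l) = b := by
        rw [map_mul, hl, ← hab, map_inv, inv_mul_cancel_left]
      obtain ⟨y, hy, rfl⟩ := hP.surj (p⁻¹ * l) v (this ▸ hv)
      have := hEl p _ x hx y hy
      rwa [mul_inv_cancel_left] at this
    exact (hb g rfl).trans (hb g' hgg'.symm).symm
  let d : A →ₗ[F] A := 𝒜.lift fun a => E (ξ a)
  have hd : ∀ g, ∀ y ∈ 𝒜.comp (QuotientGroup.mk' H g), d y = E g y := fun g y hy => by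
    refine (𝒜.lift_apply _ hy).trans (hEind _ _ (hξ _) y ?_)
    rwa [hξ]
  have hdc : d ∈ centroid F A := by
    refine mem_centroid_of_homogeneous 𝒜 d fun a b u hu v hv => ?_
    have huv := 𝒜.mul_mem _ _ _ hu _ hv
    obtain ⟨g, rfl⟩ := hπ a
    obtain ⟨l, rfl⟩ := hπ b
    rw [← map_mul] at huv
    rw [hd _ _ huv, hd _ _ hu, hd _ _ hv]
    obtain ⟨x, hx, rfl⟩ := hP.surj g u hu
    obtain ⟨y, hy, rfl⟩ := hP.surj l v hv
    exact ⟨hEl g l x hx y hy, hEr g l x hx y hy⟩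
  have hdP : ∀ g, ∀ x ∈ ℬ.comp g, P (c.1 x) = (τ.1 (k, g) : F) • d (P x) := fun g x hx => by
    rw [hd _ _ (hP.mem g x hx), hE g x hx, smul_inv_smul₀ (Units.ne_zero _)]
  refine ⟨⟨d, hdc⟩, fun a y hy => ?_, hdP⟩
  obtain ⟨g, rfl⟩ := hπ a
  obtain ⟨x, hx, rfl⟩ := hP.surj g y hy
  change d (P x) ∈ _
  rw [hd _ _ hy, hE g x hx, ← map_mul]
  exact Submodule.smul_mem _ _ (hP.mem _ _ (hc g x hx))

end IsLoopMap

namespace IsLoopMap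

variable {F G A B : Type*} [Field F] [CommGroup G] [NonUnitalNonAssocRing A] [Module F A]
  [NonUnitalNonAssocRing B] [Module F B] {H : Subgroup G}
  {ℬ : Grading F G B} {𝒜 : Grading F (G ⧸ H) A} {τ : Z2Sym G Fˣ} {P : B →ₗ[F] A}
  [IsScalarTower F A A] [SMulCommClass F A A] [IsScalarTower F B B] [SMulCommClass F B B]

/-- The homogeneous basis of the centroid of the twisted loop algebra of a central simple
algebra. -/
theorem exists_centroid_basis (hP : IsLoopMap ℬ 𝒜 τ P) (hA : IsCentralSimpleAlg F A) :
    ∃ z : H → centroid F B, (∀ h : H, z h ∈ centroidComp ℬ h) ∧ (∀ h, z h ≠ 0) ∧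
      (∀ h : H, ∀ g, ∀ x ∈ ℬ.comp g, P ((z h).1 x) = (τ.1 (h, g) : F) • P x) ∧
      (∀ h k : H, z h * z k = (τ.1 (h, k) : F) • z (h * k)) ∧
      (z 1 = (τ.1 (1, 1) : F) • 1) ∧
      ∀ k, ∀ c ∈ centroidComp ℬ k, c ≠ 0 → ∃ h : H, (h : G) = k ∧ ∃ r : F, c = r • z h := by
  have h𝒜 := hA.1.isGradedSimple 𝒜
  have hℬ := hP.isGradedSimple_of_isSimpleAlg hA.1
  have hone : ∀ h : H, (1 : centroid F A) ∈ centroidComp 𝒜 (QuotientGroup.mk' H (h : G)) := by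
    intro h
    have : QuotientGroup.mk' H (h : G) = 1 := (QuotientGroup.eq_one_iff _).2 h.2
    rw [this]
    exact one_mem_centroidComp 𝒜
  -- The identity of A has degree π(h) = 1 for every h in H, so it lifts to a centroid element of
  -- each degree h.
  choose z hz1 hz2 using fun h : H => hP.exists_centroid_lift (h : G) (hone h)
  have hz2' : ∀ h : H, ∀ g, ∀ x ∈ ℬ.comp g, P ((z h).1 x) = (τ.1 (h, g) : F) • P x := hz2
  refine ⟨z, hz1, fun h h0 => ?_, hz2', fun h k => ?_, ?_, fun k c hc hc0 => ?_⟩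
  · obtain ⟨g, x, hx, hx0⟩ := hℬ.exists_homogeneous
    have := hz2' h g x hx
    rw [h0] at this
    change P 0 = _ at this
    rw [map_zero, eq_comm, smul_eq_zero] at this
    exact hx0 (hP.inj g x hx (this.resolve_left (Units.ne_zero _)))
  · refine hP.centroid_ext (mul_mem_centroidComp (hz1 h) (hz1 k))
      (Submodule.smul_mem _ _ (hz1 (h * k))) fun g x hx => ?_
    change P ((z h).1 ((z k).1 x)) = P ((τ.1 (h, k) : F) • (z (h * k)).1 x)
    rw [hz2' h _ _ (hz1 k g x hx), hz2' k g x hx, map_smul, hz2' _ g x hx, smul_smul, smul_smul]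
    congr 1
    have := congrArg Units.val (Z2Sym.cocycle τ h k g)
    simp only [Units.val_mul] at this
    rw [H.coe_mul, this]
  · refine hP.centroid_ext (hz1 1)
      (Submodule.smul_mem _ _ (one_mem_centroidComp ℬ)) fun g x hx => ?_
    change _ = P ((τ.1 (1, 1) : F) • x)
    rw [hz2' 1 g x hx, map_smul, H.coe_one, Z2Sym.one_left]
  · obtain ⟨d, hd, hdP⟩ := hP.exists_centroid_descend h𝒜 k hc
    have hdbot : d.1 ∈ (⊥ : Subalgebra F (Module.End F A)) := hA.2 ▸ d.2
    obtain ⟨r, hr⟩ := Algebra.mem_bot.1 hdbot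
    have hdr : ∀ y, d.1 y = r • y := fun y => by rw [← hr]; rfl
    have hr0 : r ≠ 0 := by
      rintro rfl
      refine hc0 (hP.centroid_ext hc (Submodule.zero_mem _) fun g x hx => ?_)
      rw [hdP g x hx, hdr, zero_smul, smul_zero]
      exact (map_zero P).symm
    obtain ⟨a, y, hy, hy0⟩ := h𝒜.exists_homogeneous
    -- The descended element is a nonzero scalar, which preserves degrees.
    have hk : QuotientGroup.mk' H k = 1 := by
      by_contra hne
      have h1 := hd a y hy
      rw [hdr] at h1
      have h2 := 𝒜.proj_of_mem_ne (fun e => hne (mul_eq_right.1 e)) h1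
      rw [map_smul, 𝒜.proj_of_mem hy, smul_eq_zero] at h2
      exact hy0 (h2.resolve_left hr0)
    refine ⟨⟨k, (QuotientGroup.eq_one_iff _).1 hk⟩, rfl, r, ?_⟩
    refine hP.centroid_ext hc (Submodule.smul_mem _ _ (hz1 ⟨k, _⟩)) fun g x hx => ?_
    change _ = P (r • (z _).1 x)
    rw [hdP g x hx, hdr, map_smul, hz2' _ g x hx, smul_comm]

/-- In degree e the homogeneous basis of the centroid consists of `z 1`, which is the scalar τ(1,
1). -/
theorem isGradedCentralSimple (hP : IsLoopMap ℬ 𝒜 τ P) (hA : IsCentralSimpleAlg F A) :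
    IsGradedCentralSimple ℬ := by
  obtain ⟨z, -, -, -, -, hz1, hz⟩ := hP.exists_centroid_basis hA
  refine ⟨hP.isGradedSimple_of_isSimpleAlg hA.1, le_antisymm (fun c hc => ?_) ?_⟩
  · by_cases hc0 : c = 0
    · rw [hc0]
      exact Submodule.zero_mem _
    obtain ⟨h, hh, r, rfl⟩ := hz 1 c hc hc0
    obtain rfl : h = 1 := Subtype.ext hh
    rw [hz1]
    exact Submodule.smul_mem _ _ (Submodule.smul_mem _ _ (Submodule.mem_span_singleton_self _))
  · rw [Submodule.span_singleton_le_iff_mem]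
    exact one_mem_centroidComp ℬ

/-- If a twisted loop algebra of `A` is graded-central-simple and its centroid is supported in
`H`, then `A` is central simple. -/
theorem isCentralSimpleAlg_base (hP : IsLoopMap ℬ 𝒜 τ P) (hℬ : IsGradedCentralSimple ℬ)
    (hH : ∀ k, centroidComp ℬ k ≠ ⊥ → k ∈ H) : IsCentralSimpleAlg F A := by
  have h𝒜 := hP.isGradedSimple_base hℬ.1
  have hπ := QuotientGroup.mk'_surjective H
  suffices h : centroid F A = ⊥ from ⟨h𝒜.isSimpleAlg h, h⟩
  have key : ∀ a, centroidComp 𝒜 a ≤ Submodule.span F {(1 : centroid F A)} := by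
    intro a d hd
    by_cases hd0 : d = 0
    · rw [hd0]
      exact Submodule.zero_mem _
    obtain ⟨k, rfl⟩ := hπ a
    have hk : QuotientGroup.mk' H k = 1 := by
      -- A nonzero d has a nonzero lift in degree k, which forces k into the support bound H.
      obtain ⟨c, hc, hcd⟩ := hP.exists_centroid_lift k hd
      refine (QuotientGroup.eq_one_iff _).2 (hH k fun hbot => hd0 ?_)
      rw [hbot, Submodule.mem_bot] at hc
      refine Subtype.ext (𝒜.hom_ext fun b y hy => ?_)
      obtain ⟨g, rfl⟩ := hπ b
      obtain ⟨x, hx, rfl⟩ := hP.surj g y hy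
      have := hcd g x hx
      rw [hc] at this
      change P 0 = _ at this
      rw [map_zero, eq_comm, smul_eq_zero] at this
      exact this.resolve_left (Units.ne_zero _)
    rw [hk, ← map_one (QuotientGroup.mk' H)] at hd
    -- Now that d has trivial degree it can be lifted to degree 1 instead of k, where the centroid
    -- of B consists of scalars.
    obtain ⟨c, hc, hcd⟩ := hP.exists_centroid_lift 1 hd
    rw [hℬ.2] at hc
    obtain ⟨r, rfl⟩ := Submodule.mem_span_singleton.1 hc
    refine Submodule.mem_span_singleton.2 ⟨(τ.1 (1, 1) : F)⁻¹ * r, ?_⟩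
    refine Subtype.ext (𝒜.hom_ext fun b y hy => ?_)
    obtain ⟨g, rfl⟩ := hπ b
    obtain ⟨x, hx, rfl⟩ := hP.surj g y hy
    have := hcd g x hx
    change P (r • x) = _ at this
    rw [map_smul, Z2Sym.one_left] at this
    change ((τ.1 (1, 1) : F)⁻¹ * r) • P x = _
    rw [mul_smul, this, inv_smul_smul₀ (Units.ne_zero _)]
  refine eq_bot_iff.2 fun d hd => ?_
  have : (⟨d, hd⟩ : centroid F A) ∈ Submodule.span F {(1 : centroid F A)} :=
    (h𝒜.iSup_centroidComp ▸ iSup_le key :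
      (⊤ : Submodule F (centroid F A)) ≤ _) Submodule.mem_top
  obtain ⟨r, hr⟩ := Submodule.mem_span_singleton.1 this
  refine Algebra.mem_bot.2 ⟨r, ?_⟩
  rw [Algebra.algebraMap_eq_smul_one]
  exact congrArg Subtype.val hr

end IsLoopMap

/-! ### The centroid as a twisted group algebra -/

section ExtendByZero

variable {F G A : Type*} [Field F] [CommGroup G]

theorem extendByZero_coe [AddCommGroup A] [Module F A] (H : Subgroup G) (𝒜 : H → Submodule F A)
    (h : H) : extendByZero H 𝒜 (h : G) = 𝒜 h :=
  le_antisymm (iSup₂_le fun k hk => by rw [Subtype.ext hk])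
    (le_iSup₂_of_le (f := fun (k : H) (_ : (k : G) = (h : G)) => 𝒜 k) h rfl le_rfl)

theorem extendByZero_of_notMem [AddCommGroup A] [Module F A] (H : Subgroup G)
    (𝒜 : H → Submodule F A) {g : G} (hg : g ∉ H) : extendByZero H 𝒜 g = ⊥ :=
  eq_bot_iff.2 (iSup₂_le fun k hk => absurd (hk ▸ k.2) hg)

theorem mem_extendByZero [AddCommGroup A] [Module F A] {H : Subgroup G} {𝒜 : H → Submodule F A}
    {g : G} {x : A} (hx : x ∈ extendByZero H 𝒜 g) : x = 0 ∨ ∃ h : H, (h : G) = g ∧ x ∈ 𝒜 h := by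
  by_cases hg : g ∈ H
  · exact Or.inr ⟨⟨g, hg⟩, rfl, extendByZero_coe H 𝒜 ⟨g, hg⟩ ▸ hx⟩
  · rw [extendByZero_of_notMem H 𝒜 hg] at hx
    exact Or.inl hx

/-- An `H`-graded algebra as a `G`-graded algebra. -/
noncomputable def Grading.extend [NonUnitalNonAssocRing A] [Module F A] {H : Subgroup G}
    (𝒜 : Grading F H A) : Grading F G A where
  comp := extendByZero H 𝒜.comp
  indep := by
    classical
    refine iSupIndep_of_proj _ (fun g => if h : g ∈ H then 𝒜.proj ⟨g, h⟩ else 0)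
      (fun g x hx h0 => ?_) (fun g k hne x hx => ?_)
    · rcases mem_extendByZero hx with rfl | ⟨h, rfl, hx'⟩
      · rfl
      · rw [dif_pos h.2] at h0
        rwa [← 𝒜.proj_of_mem hx']
    · rcases mem_extendByZero hx with rfl | ⟨h, rfl, hx'⟩
      · exact map_zero _
      · by_cases hg : g ∈ H
        · rw [dif_pos hg]
          exact 𝒜.proj_of_mem_ne (fun e => hne (congrArg Subtype.val e)) hx'
        · rw [dif_neg hg]
          rfl
  iSup_comp := by
    rw [eq_top_iff, ← 𝒜.iSup_comp]
    exact iSup_le fun h => (extendByZero_coe H 𝒜.comp h).ge.trans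
      (le_iSup (extendByZero H 𝒜.comp) (h : G))
  mul_mem g k x hx y hy := by
    rcases mem_extendByZero hx with rfl | ⟨h, rfl, hx'⟩
    · rw [zero_mul]
      exact Submodule.zero_mem _
    rcases mem_extendByZero hy with rfl | ⟨l, rfl, hy'⟩
    · rw [mul_zero]
      exact Submodule.zero_mem _
    rw [← H.coe_mul, extendByZero_coe]
    exact 𝒜.mul_mem _ _ _ hx' _ hy'

end ExtendByZero

/-- The centroid of the twisted loop algebra of a central simple algebra is the twisted group
algebra of `H`. -/
theorem IsLoopMap.centroid_gradedIso {F G A B : Type*} [Field F] [CommGroup G]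
    [NonUnitalNonAssocRing A] [Module F A] [NonUnitalNonAssocRing B] [Module F B] {H : Subgroup G}
    {ℬ : Grading F G B} {𝒜 : Grading F (G ⧸ H) A} {τ : Z2Sym G Fˣ} {P : B →ₗ[F] A}
    [IsScalarTower F A A] [SMulCommClass F A A] [IsScalarTower F B B] [SMulCommClass F B B]
    (hP : IsLoopMap ℬ 𝒜 τ P) (hA : IsCentralSimpleAlg F A) :
    GradedIso (centroidComp ℬ)
      (extendByZero H (twistedGroupAlgGrading F (Z2Sym.comap Fˣ H.subtype τ)).comp) := by
  obtain ⟨z, hzmem, hz0, -, hzmul, -, hz⟩ := hP.exists_centroid_basis hA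
  have hℬ := hP.isGradedSimple_of_isSimpleAlg hA.1
  let Z₀ : MonoidAlgebra F H →ₗ[F] centroid F B :=
    Finsupp.linearCombination F z ∘ₗ (MonoidAlgebra.coeffLinearEquiv F).toLinearMap
  have hZ₀ : ∀ (h : H) (r : F), Z₀ (r • MonoidAlgebra.single h (1 : F)) = r • z h := fun h r => by
    simp [Z₀]
  have hspan : ∀ (h : H) (x : MonoidAlgebra F H), x ∈ (groupAlgGrading F H).comp h →
      ∃ r : F, r • MonoidAlgebra.single h (1 : F) = x := fun h x hx =>
    Submodule.mem_span_singleton.1 hx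
  have hmem : ∀ (h : H) (r : F),
      r • MonoidAlgebra.single h (1 : F) ∈ (groupAlgGrading F H).comp h := fun h r =>
    Submodule.mem_span_singleton.2 ⟨r, rfl⟩
  -- The same linear map on the twisted algebra; it is multiplicative only for the twisted product,
  -- since the z h multiply by τ.
  let Z : Twist (groupAlgGrading F H) (Z2Sym.comap Fˣ H.subtype τ) →ₗ[F] centroid F B := Z₀
  refine GradedIso.symm (gradedIso_of_linearMap
    (twistedGroupAlgGrading F (Z2Sym.comap Fˣ H.subtype τ)).extend hℬ.centroidGrading Z ?_ ?_ ?_ ?_)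
  · intro g x hx
    rcases mem_extendByZero hx with rfl | ⟨h, rfl, hx'⟩
    · rw [map_zero]
      exact Submodule.zero_mem _
    · obtain ⟨r, rfl⟩ := hspan h x hx'
      exact (hZ₀ h r).symm ▸ Submodule.smul_mem _ r (hzmem h)
  · intro g x hx h0
    rcases mem_extendByZero hx with rfl | ⟨h, rfl, hx'⟩
    · rfl
    · obtain ⟨r, rfl⟩ := hspan h x hx'
      have h1 : r • z h = 0 := (hZ₀ h r).symm.trans h0
      obtain rfl : r = 0 := (smul_eq_zero.1 h1).resolve_right (hz0 h)
      exact zero_smul F (MonoidAlgebra.single h (1 : F))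
  · intro g c hc
    by_cases hc0 : c = 0
    · exact ⟨0, Submodule.zero_mem _, by rw [hc0, map_zero]⟩
    obtain ⟨h, rfl, r, rfl⟩ := hz g c hc hc0
    refine ⟨(r • MonoidAlgebra.single h (1 : F) : MonoidAlgebra F H), ?_, hZ₀ h r⟩
    change _ ∈ extendByZero H _ (h : G)
    rw [extendByZero_coe]
    exact hmem h r
  · intro g k x hx y hy
    rcases mem_extendByZero hx with rfl | ⟨h, rfl, hx'⟩
    · rw [zero_mul, map_zero, zero_mul]
    rcases mem_extendByZero hy with rfl | ⟨l, rfl, hy'⟩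
    · rw [mul_zero, map_zero, mul_zero]
    refine (congrArg Z ((groupAlgGrading F H).twistMul_apply _ hx' hy')).trans ?_
    obtain ⟨r, rfl⟩ := hspan h x hx'
    obtain ⟨s, rfl⟩ := hspan l y hy'
    change Z₀ ((τ.1 (h, l) : F) • (r • MonoidAlgebra.single h (1 : F) *
      s • MonoidAlgebra.single l (1 : F))) = Z₀ (r • MonoidAlgebra.single h (1 : F)) *
        Z₀ (s • MonoidAlgebra.single l (1 : F))
    rw [hZ₀, hZ₀, smul_mul_smul_comm, smul_mul_smul_comm, MonoidAlgebra.single_mul_single, one_mul,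
      map_smul, hZ₀, hzmul, smul_comm]

/-! ### Isomorphisms of twisted loop algebras -/

section Classes

variable {G M : Type*} [CommGroup G] [CommGroup M] {H : Subgroup G}

/-- Turns the condition on classes into the inverse-free identity in which δ acts as a rescaling of
loop maps. -/
theorem H2Sym.mk_eq_comap_mul_iff (τ₁ τ₂ : Z2Sym G M) (μ : Z2Sym (G ⧸ H) M) :
    H2Sym.mk τ₁ = H2Sym.comap M (QuotientGroup.mk' H) (H2Sym.mk μ) * H2Sym.mk τ₂ ↔
      ∃ δ : G → M, ∀ a b : G, τ₁.1 (a, b) * δ (a * b) =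
        μ.1 (QuotientGroup.mk' H a, QuotientGroup.mk' H b) * τ₂.1 (a, b) * (δ a * δ b) := by
  have e : H2Sym.comap M (QuotientGroup.mk' H) (H2Sym.mk μ) * H2Sym.mk τ₂ =
      H2Sym.mk (Z2Sym.comap M (QuotientGroup.mk' H) μ * τ₂) := rfl
  rw [e, eq_comm, H2Sym.mk, H2Sym.mk, QuotientGroup.eq]
  refine exists_congr fun δ => forall₂_congr fun a b => ?_
  change (μ.1 (QuotientGroup.mk' H a, QuotientGroup.mk' H b) * τ₂.1 (a, b))⁻¹ * τ₁.1 (a, b) = _ ↔ _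
  rw [inv_mul_eq_iff_eq_mul, ← mul_assoc, eq_mul_inv_iff_mul_eq]

end Classes

namespace IsLoopMap

variable {F G A₁ A₂ B : Type*} [Field F] [CommGroup G] [NonUnitalNonAssocRing A₁] [Module F A₁]
  [NonUnitalNonAssocRing A₂] [Module F A₂] [NonUnitalNonAssocRing B] [Module F B]
  [IsScalarTower F A₁ A₁] [SMulCommClass F A₁ A₁] [IsScalarTower F A₂ A₂] [SMulCommClass F A₂ A₂]

/-- Twisting `A` by `μ` changes the cocycle of a twisted loop algebra by the inflation of `μ`. -/
theorem exists_of_twist {H : Subgroup G} {ℬ : Grading F G B} {𝒜₁ : Grading F (G ⧸ H) A₁}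
    {𝒜₂ : Grading F (G ⧸ H) A₂} {τ₁ τ₂ : Z2Sym G Fˣ} {P : B →ₗ[F] A₁}
    (hP : IsLoopMap ℬ 𝒜₁ τ₁ P) (μ : Z2Sym (G ⧸ H) Fˣ) (δ : G → Fˣ)
    (hδ : ∀ a b : G, τ₁.1 (a, b) * δ (a * b) =
      μ.1 (QuotientGroup.mk' H a, QuotientGroup.mk' H b) * τ₂.1 (a, b) * (δ a * δ b))
    (h : GradedIso (𝒜₁.twist μ).comp 𝒜₂.comp) :
    ∃ Q : B →ₗ[F] A₂, IsLoopMap ℬ 𝒜₂ τ₂ Q := by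
  obtain ⟨φ', hmul, hcomp⟩ := h
  let φ : A₁ →ₗ[F] A₂ := φ'.toLinearMap
  have hφmem : ∀ a, ∀ x ∈ 𝒜₁.comp a, φ x ∈ 𝒜₂.comp a := fun a x hx => hcomp a ▸ ⟨x, hx, rfl⟩
  have hφinj : ∀ x, φ x = 0 → x = 0 := fun x hx => φ'.map_eq_zero_iff.1 hx
  have hφsurj : ∀ a, ∀ y ∈ 𝒜₂.comp a, ∃ x ∈ 𝒜₁.comp a, φ x = y := fun a y hy => by
    rw [← hcomp a] at hy
    exact hy
  have hφmul : ∀ a b, ∀ x ∈ 𝒜₁.comp a, ∀ y ∈ 𝒜₁.comp b,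
      (μ.1 (a, b) : F) • φ (x * y) = φ x * φ y := fun a b x hx y hy => by
    rw [← map_smul, ← 𝒜₁.twistMul_apply μ hx hy]
    exact hmul x y
  -- Rescaling by δ(g) in degree g absorbs the coboundary, while φ absorbs μ.
  have hQ : ∀ g, ∀ x ∈ ℬ.comp g,
      ℬ.lift (fun g => (δ g : F) • (φ ∘ₗ P)) x = (δ g : F) • φ (P x) := fun g x hx =>
    ℬ.lift_apply _ hx
  refine ⟨ℬ.lift fun g => (δ g : F) • (φ ∘ₗ P), fun g x hx => ?_, fun g x hx h0 => ?_,
    fun g a ha => ?_, fun g k x hx y hy => ?_⟩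
  · rw [hQ g x hx]
    exact Submodule.smul_mem _ _ (hφmem _ _ (hP.mem g x hx))
  · rw [hQ g x hx, smul_eq_zero] at h0
    exact hP.inj g x hx (hφinj _ (h0.resolve_left (Units.ne_zero _)))
  · obtain ⟨y, hy, rfl⟩ := hφsurj _ a ha
    obtain ⟨x, hx, rfl⟩ := hP.surj g y hy
    refine ⟨(δ g : F)⁻¹ • x, Submodule.smul_mem _ _ hx, ?_⟩
    rw [map_smul, hQ g x hx, inv_smul_smul₀ (Units.ne_zero _)]
  · rw [hQ _ _ (ℬ.mul_mem _ _ _ hx _ hy), hQ g x hx, hQ k y hy, hP.mul g k x hx y hy, map_smul,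
      smul_mul_smul_comm, ← hφmul _ _ _ (hP.mem g x hx) _ (hP.mem k y hy), smul_smul, smul_smul,
      smul_smul]
    congr 1
    have := congrArg Units.val (hδ g k)
    simp only [Units.val_mul] at this
    linear_combination this

variable [IsScalarTower F B B] [SMulCommClass F B B]

/-- The subgroup `H` is determined by the twisted loop algebra of a central simple algebra. -/
theorem subgroup_le {H₁ H₂ : Subgroup G} {ℬ : Grading F G B} {𝒜₁ : Grading F (G ⧸ H₁) A₁}
    {𝒜₂ : Grading F (G ⧸ H₂) A₂} {τ₁ τ₂ : Z2Sym G Fˣ} {P₁ : B →ₗ[F] A₁} {P₂ : B →ₗ[F] A₂}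
    (hP₁ : IsLoopMap ℬ 𝒜₁ τ₁ P₁) (hP₂ : IsLoopMap ℬ 𝒜₂ τ₂ P₂) (hA₁ : IsCentralSimpleAlg F A₁)
    (hA₂ : IsCentralSimpleAlg F A₂) : H₁ ≤ H₂ := by
  obtain ⟨z, hz, hz0, -⟩ := hP₁.exists_centroid_basis hA₁
  obtain ⟨w, -, -, -, -, -, hw⟩ := hP₂.exists_centroid_basis hA₂
  intro g hg
  obtain ⟨h, rfl, -⟩ := hw g _ (hz ⟨g, hg⟩) (hz0 _)
  exact h.2

/-- If an algebra is a twisted loop algebra of two central simple algebras `A₁` and `A₂`, then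
`A₂` is a twist of `A₁`, compatibly with the cocycles. -/
theorem exists_twist {H : Subgroup G} {ℬ : Grading F G B} {𝒜₁ : Grading F (G ⧸ H) A₁}
    {𝒜₂ : Grading F (G ⧸ H) A₂} {τ₁ τ₂ : Z2Sym G Fˣ} {P₁ : B →ₗ[F] A₁} {P₂ : B →ₗ[F] A₂}
    (hP₁ : IsLoopMap ℬ 𝒜₁ τ₁ P₁) (hP₂ : IsLoopMap ℬ 𝒜₂ τ₂ P₂) (hA₁ : IsCentralSimpleAlg F A₁)
    (hA₂ : IsCentralSimpleAlg F A₂) :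
    ∃ μ : Z2Sym (G ⧸ H) Fˣ, (∃ δ : G → Fˣ, ∀ a b : G, τ₁.1 (a, b) * δ (a * b) =
      μ.1 (QuotientGroup.mk' H a, QuotientGroup.mk' H b) * τ₂.1 (a, b) * (δ a * δ b)) ∧
      GradedIso (𝒜₁.twist μ).comp 𝒜₂.comp := by
  have hπ := QuotientGroup.mk'_surjective H
  obtain ⟨z, hz, hz0, hzP, hzmul, -⟩ := hP₁.exists_centroid_basis hA₁
  obtain ⟨w, -, hw0, hwP, hwmul, -, hw⟩ := hP₂.exists_centroid_basis hA₂
  -- Both families are bases of the same centroid with one vector in each degree of H, so they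
  -- differ by nonzero scalars.
  have hex : ∀ h : H, ∃ r : Fˣ, z h = (r : F) • w h := fun h => by
    obtain ⟨k, hk, r, hr⟩ := hw h _ (hz h) (hz0 h)
    obtain rfl : k = h := Subtype.ext hk
    refine ⟨Units.mk0 r ?_, hr⟩
    rintro rfl
    exact hz0 k (by rw [hr, zero_smul])
  choose γ hγ using hex
  have hγmul : ∀ a b : H, τ₁.1 (a, b) * γ (a * b) = τ₂.1 (a, b) * (γ a * γ b) := fun a b => by
    have h1 := hzmul a b
    rw [hγ a, hγ b, hγ (a * b), smul_mul_smul_comm, hwmul, smul_smul, smul_smul] at h1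
    have h2 := smul_left_injective F (hw0 (a * b)) h1
    refine Units.ext ?_
    simp only [Units.val_mul]
    linear_combination -h2
  obtain ⟨δ, μ, hδγ, hδ⟩ := Z2Sym.exists_descend H τ₁ τ₂ γ hγmul
  -- Since δ extends γ, comparing the two relations at (1, 1) shows that μ is normalized.
  have hμ1 : ∀ a, μ.1 (1, a) = 1 := fun a => by
    have h1 := hγmul 1 1
    have h2 := hδ 1 1
    have h3 := hδγ 1
    rw [H.coe_one] at h1 h3
    rw [mul_one, map_one, h3] at h2
    rw [mul_one, h2, mul_assoc] at h1
    rw [Z2Sym.one_left]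
    exact mul_eq_right.1 h1
  obtain ⟨ξ, hξ, -⟩ := exists_section_one H
  obtain ⟨ρ, hρ1, -, -⟩ := hP₁.exists_section
  -- Defined through lifts to the representative degree ξ(a).
  let ψ : A₁ →ₗ[F] A₂ := 𝒜₁.lift fun a => (δ (ξ a) : F)⁻¹ • (P₂ ∘ₗ ρ (ξ a))
  have hψ₀ : ∀ a, ∀ x ∈ ℬ.comp (ξ a), ψ (P₁ x) = (δ (ξ a) : F)⁻¹ • P₂ x := fun a x hx => by
    have h1 := hP₁.mem _ x hx
    rw [hξ] at h1
    refine (𝒜₁.lift_apply _ h1).trans ?_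
    simp only [LinearMap.smul_apply, LinearMap.comp_apply, hρ1 _ x hx]
  -- Independence of the representative: z h moves x to the representative degree. It changes P₁ x
  -- by τ₁(h, g) and P₂ x by γ(h)τ₂(h, g), and these match because δ(h) = γ(h) and μ is trivial at
  -- (1, π(g)).
  have hψ : ∀ g, ∀ x ∈ ℬ.comp g, ψ (P₁ x) = (δ g : F)⁻¹ • P₂ x := fun g x hx => by
    have hmem : ξ (QuotientGroup.mk' H g) * g⁻¹ ∈ H := by
      refine (QuotientGroup.eq_one_iff (N := H) _).1 ?_
      change QuotientGroup.mk' H (_ * _) = 1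
      rw [map_mul, hξ, map_inv, mul_inv_cancel]
    let h : H := ⟨_, hmem⟩
    have hh : (h : G) * g = ξ (QuotientGroup.mk' H g) := inv_mul_cancel_right _ _
    have hzx := hz h g x hx
    rw [hh] at hzx
    have h1 := hψ₀ _ _ hzx
    have h2 : P₂ ((z h).1 x) = (γ h : F) • (τ₂.1 (h, g) : F) • P₂ x := by
      rw [hγ h, ← hwP h g x hx, ← map_smul]
      rfl
    rw [h2, hzP h g x hx, map_smul] at h1
    have h3 := hδ h g
    have h4 : QuotientGroup.mk' H (h : G) = 1 := (QuotientGroup.eq_one_iff _).2 h.2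
    rw [hh, h4, hμ1, one_mul, hδγ] at h3
    have h5 := congrArg Units.val h3
    simp only [Units.val_mul] at h5
    rw [← inv_smul_smul₀ (Units.ne_zero (τ₁.1 ((h : G), g))) (ψ (P₁ x)), h1, smul_smul, smul_smul,
      smul_smul]
    congr 1
    field_simp
    linear_combination -h5
  refine ⟨μ, ⟨δ, hδ⟩, gradedIso_of_linearMap (𝒜₁.twist μ) 𝒜₂
    (show Twist 𝒜₁ μ →ₗ[F] A₂ from ψ) ?_ ?_ ?_ ?_⟩
  · intro a y hy
    obtain ⟨g, rfl⟩ := hπ a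
    obtain ⟨x, hx, rfl⟩ := hP₁.surj g y hy
    change ψ (P₁ x) ∈ _
    rw [hψ g x hx]
    exact Submodule.smul_mem _ _ (hP₂.mem g x hx)
  · intro a y hy h0
    obtain ⟨g, rfl⟩ := hπ a
    obtain ⟨x, hx, rfl⟩ := hP₁.surj g y hy
    change ψ (P₁ x) = 0 at h0
    rw [hψ g x hx, smul_eq_zero] at h0
    rw [hP₂.inj g x hx (h0.resolve_left (inv_ne_zero (Units.ne_zero _)))]
    exact map_zero P₁
  · intro a y hy
    obtain ⟨g, rfl⟩ := hπ a
    obtain ⟨x, hx, rfl⟩ := hP₂.surj g y hy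
    refine ⟨P₁ ((δ g : F) • x), hP₁.mem g _ (Submodule.smul_mem _ _ hx), ?_⟩
    change ψ _ = _
    rw [hψ g _ (Submodule.smul_mem _ _ hx), map_smul, inv_smul_smul₀ (Units.ne_zero _)]
  · intro a b u hu v hv
    refine (congrArg ψ (𝒜₁.twistMul_apply μ hu hv)).trans ?_
    obtain ⟨g, rfl⟩ := hπ a
    obtain ⟨k, rfl⟩ := hπ b
    obtain ⟨x, hx, rfl⟩ := hP₁.surj g u hu
    obtain ⟨y, hy, rfl⟩ := hP₁.surj k v hv
    change _ = ψ (P₁ x) * ψ (P₁ y)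
    rw [map_smul, hP₁.smul_inv_mul hx hy, map_smul, hψ _ _ (ℬ.mul_mem _ _ _ hx _ hy), hψ g x hx,
      hψ k y hy, hP₂.mul g k x hx y hy, smul_mul_smul_comm, smul_smul, smul_smul, smul_smul]
    congr 1
    have := congrArg Units.val (hδ g k)
    simp only [Units.val_mul] at this
    field_simp
    linear_combination -this

end IsLoopMap

/-! ### Realization of graded-central-simple algebras as twisted loop algebras -/

section BilinAlg

variable {F V : Type*} [Field F] [AddCommGroup V] [Module F V]

/-- The algebra with underlying space `V` and multiplication `m`. -/
def BilinAlg (_ : V →ₗ[F] V →ₗ[F] V) : Type _ := V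

variable (m : V →ₗ[F] V →ₗ[F] V)

instance : AddCommGroup (BilinAlg m) := inferInstanceAs (AddCommGroup V)

instance : NonUnitalNonAssocRing (BilinAlg m) where
  mul x y := m x y
  left_distrib x y z := map_add (m x) y z
  right_distrib x y z := LinearMap.map_add₂ m x y z
  zero_mul x := LinearMap.map_zero₂ m x
  mul_zero x := map_zero (m x)

instance : Module F (BilinAlg m) := inferInstanceAs (Module F V)

instance : IsScalarTower F (BilinAlg m) (BilinAlg m) where
  smul_assoc r x y := LinearMap.map_smul₂ m r x y

instance : SMulCommClass F (BilinAlg m) (BilinAlg m) where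
  smul_comm r x y := (map_smul (m x) r y).symm

end BilinAlg

section Realize

universe v

variable {F G : Type*} {B : Type v} [Field F] [CommGroup G] [NonUnitalNonAssocRing B] [Module F B]
  [IsScalarTower F B B] [SMulCommClass F B B] {ℬ : Grading F G B}

/-- The support of the centroid of a graded-simple algebra is a subgroup. -/
def IsGradedSimple.centroidSupport (hℬ : IsGradedSimple ℬ) : Subgroup G where
  carrier := {g | centroidComp ℬ g ≠ ⊥}
  one_mem' := fun h => hℬ.centroid_one_ne_zero
    ((Submodule.mem_bot F).1 (h ▸ one_mem_centroidComp ℬ))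
  mul_mem' := fun {g k} hg hk h => by
    obtain ⟨c, hc, hc0⟩ := Submodule.exists_mem_ne_zero_of_ne_bot hg
    obtain ⟨d, hd, hd0⟩ := Submodule.exists_mem_ne_zero_of_ne_bot hk
    exact hℬ.centroid_mul_ne_zero hc hc0 hd0
      ((Submodule.mem_bot F).1 (h ▸ mul_mem_centroidComp hc hd))
  inv_mem' := fun {g} hg h => by
    obtain ⟨c, hc, hc0⟩ := Submodule.exists_mem_ne_zero_of_ne_bot hg
    obtain ⟨d, hd, hdc, -⟩ := hℬ.exists_centroid_inv hc hc0
    rw [h, Submodule.mem_bot] at hd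
    rw [hd, zero_mul] at hdc
    exact hℬ.centroid_one_ne_zero hdc.symm

/-- The homogeneous components of the centroid of a graded-central-simple algebra have dimension
at most one. -/
theorem IsGradedCentralSimple.exists_smul (hℬ : IsGradedCentralSimple ℬ) {g : G}
    {c d : centroid F B} (hc : c ∈ centroidComp ℬ g) (hc0 : c ≠ 0) (hd : d ∈ centroidComp ℬ g) :
    ∃ r : F, d = r • c := by
  obtain ⟨e, he, -, hce⟩ := hℬ.1.exists_centroid_inv hc hc0
  have h := mul_mem_centroidComp he hd
  rw [inv_mul_cancel, hℬ.2] at h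
  obtain ⟨r, hr⟩ := Submodule.mem_span_singleton.1 h
  refine ⟨r, ?_⟩
  rw [← one_mul d, ← hce, mul_assoc, ← hr, mul_smul_comm, mul_one]

/-- Nonzero homogeneous elements of the centroid can be chosen to multiply according to a symmetric
cocycle on `G`. -/
theorem IsGradedCentralSimple.exists_cocycle (hℬ : IsGradedCentralSimple ℬ) :
    ∃ (u : hℬ.1.centroidSupport → centroid F B) (τ : Z2Sym G Fˣ),
      (∀ h : hℬ.1.centroidSupport, u h ∈ centroidComp ℬ (h : G)) ∧ (∀ h, u h ≠ 0) ∧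
      ∀ h k : hℬ.1.centroidSupport, u h * u k = (τ.1 (h, k) : F) • u (h * k) := by
  choose u hu hu0 using fun h : hℬ.1.centroidSupport =>
    Submodule.exists_mem_ne_zero_of_ne_bot h.2
  have hex : ∀ h k, ∃ r : Fˣ, u h * u k = (r : F) • u (h * k) := fun h k => by
    obtain ⟨r, hr⟩ := hℬ.exists_smul (hu (h * k)) (hu0 _) (mul_mem_centroidComp (hu h) (hu k))
    refine ⟨Units.mk0 r ?_, hr⟩
    rintro rfl
    rw [zero_smul] at hr
    exact hℬ.1.centroid_mul_ne_zero (hu h) (hu0 h) (hu0 k) hr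
  choose s hs using hex
  have hinj : ∀ h (r r' : Fˣ), (r : F) • u h = (r' : F) • u h → r = r' := fun h r r' e =>
    Units.ext (smul_left_injective F (hu0 h) e)
  -- Associativity of the centroid gives the cocycle identity, and commutativity gives symmetry.
  let σ : Z2Sym hℬ.1.centroidSupport Fˣ := ⟨fun p => s p.1 p.2, fun a b c => by
    refine hinj (a * b * c) _ _ ?_
    have h := mul_assoc (u a) (u b) (u c)
    rw [hs a b, hs b c, smul_mul_assoc, mul_smul_comm, hs, hs, smul_smul, smul_smul, ← mul_assoc]
      at h
    simp only [Units.val_mul]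
    rw [h, mul_comm], fun a b => by
    refine hinj (a * b) _ _ ?_
    rw [← hs, hℬ.1.centroid_commute, hs, mul_comm a b]⟩
  obtain ⟨τ, hτ⟩ := Z2Sym.exists_extend _ σ
  refine ⟨u, τ, hu, hu0, fun h k => ?_⟩
  rw [hτ h k]
  exact hs h k

/-- A graded-simple algebra with homogeneous elements `u h` of the centroid multiplying according to
a cocycle is a twisted loop algebra. -/
theorem IsGradedSimple.exists_isLoopMap (hℬ : IsGradedSimple ℬ) {H : Subgroup G}
    (u : H → centroid F B) (τ : Z2Sym G Fˣ) (hu : ∀ h : H, u h ∈ centroidComp ℬ (h : G))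
    (hu0 : ∀ h, u h ≠ 0) (humul : ∀ h k : H, u h * u k = (τ.1 (h, k) : F) • u (h * k)) :
    ∃ (A : Type v) (_ : NonUnitalNonAssocRing A) (_ : Module F A) (_ : IsScalarTower F A A)
      (_ : SMulCommClass F A A) (𝒜 : Grading F (G ⧸ H) A) (P : B →ₗ[F] A),
      IsLoopMap ℬ 𝒜 τ P := by
  obtain ⟨ξ, hξ, -⟩ := exists_section_one H
  have hκmem : ∀ g, ξ (QuotientGroup.mk' H g) * g⁻¹ ∈ H := fun g => by
    refine (QuotientGroup.eq_one_iff (N := H) _).1 ?_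
    change QuotientGroup.mk' H (_ * _) = 1
    rw [map_mul, hξ, map_inv, mul_inv_cancel]
  -- The element of H that moves g to the chosen representative of its coset.
  let κ : G → H := fun g => ⟨_, hκmem g⟩
  have hκ : ∀ g, (κ g : G) * g = ξ (QuotientGroup.mk' H g) := fun g => inv_mul_cancel_right _ _
  have hκmul : ∀ (h : H) g, κ (h * g) * h = κ g := fun h g => by
    have h1 : QuotientGroup.mk' H (h : G) = 1 := (QuotientGroup.eq_one_iff _).2 h.2
    refine Subtype.ext (mul_right_cancel (b := g) ?_)
    rw [hκ, H.coe_mul, mul_assoc, hκ, map_mul, h1, one_mul]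
  -- Takes the place of the quotient map for the relations u h x = τ(h, g) x: every element is moved
  -- to the representative degree of its coset, with the scalar these relations dictate.
  let p : B →ₗ[F] B := ℬ.lift fun g => (τ.1 (κ g, g) : F)⁻¹ • (u (κ g)).1
  have hp : ∀ g, ∀ x ∈ ℬ.comp g, p x = (τ.1 (κ g, g) : F)⁻¹ • (u (κ g)).1 x := fun g x hx =>
    ℬ.lift_apply _ hx
  have hpmem : ∀ g, ∀ x ∈ ℬ.comp g, p x ∈ ℬ.comp (ξ (QuotientGroup.mk' H g)) := fun g x hx => by
    rw [hp g x hx, ← hκ]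
    exact Submodule.smul_mem _ _ (hu _ g x hx)
  -- `p` is invariant under the action of the `u h`
  have hpu : ∀ (h : H) g, ∀ x ∈ ℬ.comp g, p ((u h).1 x) = (τ.1 (h, g) : F) • p x := by
    intro h g x hx
    rw [hp _ _ (hu h g x hx), hp g x hx]
    have h1 : (u (κ (h * g))).1 ((u h).1 x) = (τ.1 (κ (h * g), h) : F) • (u (κ g)).1 x := by
      have := LinearMap.congr_fun (congrArg Subtype.val (humul (κ (h * g)) h)) x
      rw [hκmul] at this
      exact this
    have h2 := congrArg Units.val (Z2Sym.cocycle τ (κ (h * g) : G) h g)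
    rw [← H.coe_mul, hκmul] at h2
    simp only [Units.val_mul] at h2
    rw [h1, smul_smul, smul_smul]
    congr 1
    field_simp
    linear_combination h2
  let S : Submodule F B := ⨆ a, ℬ.comp (ξ a)
  have hpS : ∀ x, p x ∈ S := fun x => by
    induction x using ℬ.induction with
    | zero => rw [map_zero]; exact S.zero_mem
    | add x y hx hy => rw [map_add]; exact S.add_mem hx hy
    | hom g x hx => exact Submodule.mem_iSup_of_mem _ (hpmem g x hx)
  let Q : B →ₗ[F] S := p.codRestrict S hpS
  -- A product of two representative degrees need not be a representative, so p is applied once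
  -- more; the twist by τ⁻¹ cancels the factor τ(g, k) required of a loop map.
  let m : S →ₗ[F] S →ₗ[F] S :=
    ((ℬ.twistMul τ⁻¹).compl₁₂ S.subtype S.subtype).compr₂ Q
  let P : B →ₗ[F] BilinAlg m := Q
  have hξinj : Function.Injective ξ := Function.LeftInverse.injective hξ
  have hStop : ⨆ a, (ℬ.comp (ξ a)).comap S.subtype = ⊤ := by
    apply Submodule.map_injective_of_injective S.injective_subtype
    rw [Submodule.map_iSup, Submodule.map_top, Submodule.range_subtype]
    refine iSup_congr fun a => ?_
    rw [Submodule.map_comap_subtype]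
    exact inf_eq_right.2 (le_iSup (fun a => ℬ.comp (ξ a)) a)
  let 𝒜 : Grading F (G ⧸ H) (BilinAlg m) :=
    { comp := fun a => (ℬ.comp (ξ a)).comap S.subtype
      indep := iSupIndep_of_proj (F := F) (V := S) (W := B) _
        (fun a => ℬ.proj (ξ a) ∘ₗ S.subtype)
        (fun a x hx h0 => Subtype.ext (by
          rw [← ℬ.proj_of_mem (show (x : B) ∈ _ from hx)]
          exact h0))
        (fun a b hne x hx => ℬ.proj_of_mem_ne (fun e => hne (hξinj e)) hx)
      iSup_comp := hStop
      mul_mem := fun a b x hx y hy => by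
        have h1 : p (ℬ.twistMul τ⁻¹ (S.subtype x) (S.subtype y)) ∈
            ℬ.comp (ξ (QuotientGroup.mk' H (ξ a * ξ b))) := by
          refine hpmem _ _ ?_
          rw [ℬ.twistMul_apply τ⁻¹ (show S.subtype x ∈ _ from hx) (show S.subtype y ∈ _ from hy)]
          exact Submodule.smul_mem _ _ (ℬ.mul_mem _ _ _ hx _ hy)
        rw [map_mul, hξ, hξ] at h1
        exact h1 }
  refine ⟨BilinAlg m, inferInstance, inferInstance, inferInstance, inferInstance, 𝒜, P,
    fun g x hx => hpmem g x hx, fun g x hx h0 => ?_, fun g a ha => ?_, fun g k x hx y hy => ?_⟩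
  · have h1 : p x = 0 := congrArg Subtype.val h0
    rw [hp g x hx, smul_eq_zero] at h1
    by_contra hx0
    exact hu0 _ (hℬ.centroid_eq_zero hx hx0
      (h1.resolve_left (inv_ne_zero (Units.ne_zero _))))
  · have ha' : S.subtype a ∈ ℬ.comp ((κ g : G) * g) := by
      rw [hκ]
      exact ha
    obtain ⟨x, hx, hxa⟩ := hℬ.exists_preimage (hu (κ g)) (hu0 _) ha'
    refine ⟨(τ.1 (κ g, g) : F) • x, Submodule.smul_mem _ _ hx, Subtype.ext ?_⟩
    change p ((τ.1 (κ g, g) : F) • x) = S.subtype a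
    rw [map_smul, hp g x hx, smul_inv_smul₀ (Units.ne_zero _), hxa]
  · refine Subtype.ext ?_
    change p (x * y) = (τ.1 (g, k) : F) • p (ℬ.twistMul τ⁻¹ (p x) (p y))
    have hux := hu (κ g) g x hx
    have huy := hu (κ k) k y hy
    have hxy := ℬ.mul_mem _ _ _ hx _ hy
    have h1 : (u (κ g)).1 x * (u (κ k)).1 y = (u (κ g)).1 ((u (κ k)).1 (x * y)) := by
      rw [← centroid.map_mul_left, ← centroid.map_mul_right]
    rw [hp g x hx, hp k y hy, map_smul, LinearMap.map_smul₂, map_smul,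
      ℬ.twistMul_apply τ⁻¹ hux huy, h1, map_smul, map_smul,
      hpu _ _ _ (hu (κ k) _ _ hxy), hpu _ _ _ hxy]
    simp only [smul_smul]
    -- Moving x and y separately to their representatives costs the same scalars as moving xy by
    -- κ(k) and then κ(g), up to τ(g, k). This combines the cocycle identities at (κ(g), g, κ(k)k),
    -- (g, κ(k), k) and (κ(k), g, k) with symmetry.
    have hτ : τ.1 (g, k) * τ.1 (κ g, (κ k : G) * (g * k)) * τ.1 (κ k, g * k) =
        τ.1 ((κ g : G) * g, (κ k : G) * k) * τ.1 (κ g, g) * τ.1 (κ k, k) := by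
      have c1 := Z2Sym.cocycle τ (κ g : G) g ((κ k : G) * k)
      have c2 := Z2Sym.cocycle τ g (κ k : G) k
      have c3 := Z2Sym.cocycle τ (κ k : G) g k
      rw [mul_comm (τ.1 ((κ g : G) * g, _)), c1,
        mul_assoc (τ.1 ((κ g : G), g * _)), ← c2, Z2Sym.symm τ g (κ k), mul_comm g (κ k : G), c3,
        mul_left_comm g (κ k : G) k, mul_assoc, mul_comm (τ.1 (g, k)), mul_assoc]
    have hinv : ((τ⁻¹).1 ((κ g : G) * g, (κ k : G) * k) : F) =
        (τ.1 ((κ g : G) * g, (κ k : G) * k) : F)⁻¹ := Units.val_inv_eq_inv_val _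
    have hτ' := congrArg Units.val hτ
    simp only [Units.val_mul] at hτ'
    rw [hinv]
    conv_lhs => rw [← one_smul F (p (x * y))]
    congr 1
    field_simp
    linear_combination -hτ'

end Realize

theorem comp_quotientMulEquivOfEq_rfl {G X : Type*} [CommGroup G] {H : Subgroup G}
    (f : G ⧸ H → X) : (fun g => f (QuotientGroup.quotientMulEquivOfEq (rfl : H = H) g)) = f := by
  funext g
  induction g using QuotientGroup.induction_on
  rfl

-- Assembly of the three statements

universe u w v v₁ v₂

theorem theorem4p2 {F : Type u} [Field F] {G : Type w} [CommGroup G] :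
    -- (1)
    (∀ (B : Type v) [NonUnitalNonAssocRing B] [Module F B] [IsScalarTower F B B]
        [SMulCommClass F B B] (ℬ : Grading F G B), IsGradedCentralSimple ℬ →
      ∃ H : Subgroup G, (∀ g : G, g ∈ H ↔ centroidComp ℬ g ≠ ⊥) ∧
        ∃ (A : Type v) (_ : NonUnitalNonAssocRing A) (_ : Module F A) (_ : IsScalarTower F A A)
          (_ : SMulCommClass F A A) (𝒜 : Grading F (G ⧸ H) A) (τ : Z2Sym G Fˣ),
          IsCentralSimpleAlg F A ∧ GradedIso ℬ.comp (twistedLoopGrading 𝒜 τ).comp) ∧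
    -- (2)
    (∀ (H : Subgroup G) (A : Type v) [NonUnitalNonAssocRing A] [Module F A]
        [IsScalarTower F A A] [SMulCommClass F A A] (𝒜 : Grading F (G ⧸ H) A)
        (τ : Z2Sym G Fˣ), IsCentralSimpleAlg F A →
      IsGradedCentralSimple (twistedLoopGrading 𝒜 τ) ∧
      GradedIso (centroidComp (twistedLoopGrading 𝒜 τ))
        (extendByZero H (twistedGroupAlgGrading F (Z2Sym.comap Fˣ H.subtype τ)).comp)) ∧
    -- (3)
    (∀ (H₁ H₂ : Subgroup G)
        (A₁ : Type v₁) [NonUnitalNonAssocRing A₁] [Module F A₁]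
        [IsScalarTower F A₁ A₁] [SMulCommClass F A₁ A₁]
        (A₂ : Type v₂) [NonUnitalNonAssocRing A₂] [Module F A₂]
        [IsScalarTower F A₂ A₂] [SMulCommClass F A₂ A₂]
        (𝒜₁ : Grading F (G ⧸ H₁) A₁) (𝒜₂ : Grading F (G ⧸ H₂) A₂) (τ₁ τ₂ : Z2Sym G Fˣ),
        IsCentralSimpleAlg F A₁ → IsCentralSimpleAlg F A₂ →
      (GradedIso (twistedLoopGrading 𝒜₁ τ₁).comp (twistedLoopGrading 𝒜₂ τ₂).comp ↔
        ∃ hH : H₁ = H₂, ∃ μ : Z2Sym (G ⧸ H₁) Fˣ,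
          H2Sym.mk τ₁ = H2Sym.comap Fˣ (QuotientGroup.mk' H₁) (H2Sym.mk μ) * H2Sym.mk τ₂ ∧
          GradedIso (𝒜₁.twist μ).comp
            (fun g => 𝒜₂.comp (QuotientGroup.quotientMulEquivOfEq hH g)))) := by
  refine ⟨fun B _ _ _ _ ℬ hℬ => ?_, fun H A _ _ _ _ 𝒜 τ hA => ?_,
    fun H₁ H₂ A₁ _ _ _ _ A₂ _ _ _ _ 𝒜₁ 𝒜₂ τ₁ τ₂ hA₁ hA₂ => ⟨fun h => ?_, ?_⟩⟩
  · refine ⟨hℬ.1.centroidSupport, fun g => Iff.rfl, ?_⟩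
    obtain ⟨u, τ, hu, hu0, humul⟩ := hℬ.exists_cocycle
    obtain ⟨A, i₁, i₂, i₃, i₄, 𝒜, P, hP⟩ := hℬ.1.exists_isLoopMap u τ hu hu0 humul
    exact ⟨A, i₁, i₂, i₃, i₄, 𝒜, τ, hP.isCentralSimpleAlg_base hℬ fun k hk => hk,
      hP.gradedIso (isLoopMap_loopMap 𝒜 τ)⟩
  · have hP := isLoopMap_loopMap 𝒜 τ
    exact ⟨hP.isGradedCentralSimple hA, hP.centroid_gradedIso hA⟩
  · have hP₁ := isLoopMap_loopMap 𝒜₁ τ₁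
    -- Transport along the isomorphism presents a single algebra as a twisted loop algebra in two
    -- ways.
    obtain ⟨P₂, hP₂⟩ := (isLoopMap_loopMap 𝒜₂ τ₂).comp_gradedIso h
    obtain rfl : H₁ = H₂ :=
      le_antisymm (hP₁.subgroup_le hP₂ hA₁ hA₂) (hP₂.subgroup_le hP₁ hA₂ hA₁)
    obtain ⟨μ, hδ, hiso⟩ := hP₁.exists_twist hP₂ hA₁ hA₂
    refine ⟨rfl, μ, (H2Sym.mk_eq_comap_mul_iff τ₁ τ₂ μ).2 hδ, ?_⟩
    rw [comp_quotientMulEquivOfEq_rfl]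
    exact hiso
  · rintro ⟨rfl, μ, hμ, hiso⟩
    obtain ⟨δ, hδ⟩ := (H2Sym.mk_eq_comap_mul_iff τ₁ τ₂ μ).1 hμ
    rw [comp_quotientMulEquivOfEq_rfl] at hiso
    obtain ⟨Q, hQ⟩ := (isLoopMap_loopMap 𝒜₁ τ₁).exists_of_twist μ δ hδ hiso
    exact hQ.gradedIso (isLoopMap_loopMap 𝒜₂ τ₂)
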